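/- Let $\mathbb T$ be the unit circle with normalized Lebesgue measure $\ell$, let $I\subset\mathbb T$ be a finite union of closed arcs and $J=\mathbb T\setminus I$, with $\ell(I)>0$ and $\ell(J)>0$. Let $H^2$ be the space of functions in $L^2(\mathbb T)$ whose Fourier coefficients of strictly negative index vanish, and for $n\ge 0$ let $T_n$ be the space of polynomials $q(e^{i\theta})$ in $e^{i\theta}$ of degree at most $n$ with complex coefficients. Let $f\in L^2(I)$. Let $g_0$ be the solution of the bounded extremal problem $BEP_{2,\infty}$: $g_0\in H^2$, $|g_0|\le 1$ a.e. on $J$, and $$\|f-g_0\|_{L^2(I)}=\min\{\|f-g\|_{L^2(I)} : g\in H^2,\ |g|\le 1\text{ a.e. on }J\}.$$ For each $n\geq 0$ let $k_n$ be the solution of its polynomial version $FBEP^n_{2,\infty}$: $k_n\in T_n$, $|k_n|\le 1$ a.e. on $J$, and $$\|f-k_n\|_{L^2(I)}=\min\{\|f-g\|_{L^2(I)} : g\in T_n,\ |g|\le 1\text{ a.e. on }J\}.$$ (a) As $n\to\infty$, $\|g_0-k_n\|_{L^2(I)}\to 0$, and $k_n\to g_0$ weak-* in $L^\infty(J)$,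 that is, $$\lim_{n\to\infty}\frac1{2\pi}\int_J k_n(e^{i\theta})\,\overline{h(e^{i\theta})}\,d\theta=\frac1{2\pi}\int_J g_0(e^{i\theta})\,\overline{h(e^{i\theta})}\,d\theta\qquad\text{for every } h\in L^1(J).$$ (b) Assume moreover that every $g\in H^2$ such that $|g|\le1$ a.e. on $J$ and $g=f$ a.e. on $I$ satisfies $|g|=1$ a.e. on $J$ (this holds in particular if $f$ is not the trace on $I$ of any $g\in H^2$ with $|g|\le 1$ a.e. on $J$). Then $$\lim_{n\to\infty}\|g_0-k_n\|_{L^2(\mathbb T)}=0\qquad\text{and}\qquad \lim_{n\to\infty}\|g_0-k_n\|_{L^p(J)}=0\quad\text{for every }1\le p<\infty.$$ -/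

import Mathlib

open Filter Topology MeasureTheory AddCircle
open scoped Real ENNReal

/-- The unit circle, parametrized by the angle `θ` modulo `2π`; the point `e^{iθ}` is
`fourier 1 θ`. Its normalized Lebesgue measure is Mathlib's `haarAddCircle`. -/
abbrev UnitTorus : Type := AddCircle (2 * π)

instance unitTorusFact : Fact (0 < 2 * π) := ⟨Real.two_pi_pos⟩

namespace BoundedExtremal

/-- Normalized Lebesgue measure on the circle. -/
noncomputable def ell : Measure UnitTorus := haarAddCircle

/-- The norm `‖h‖_{L^p(E)}`, with values in `[0, ∞]`. -/
noncomputable def lpNormOn (p : ℝ≥0∞) (E : Set UnitTorus) (h : UnitTorus → ℂ) : ℝ≥0∞ :=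
  eLpNorm h p (ell.restrict E)

/-- `h ∈ L^p(E)`. -/
def MemLpOn (p : ℝ≥0∞) (E : Set UnitTorus) (h : UnitTorus → ℂ) : Prop :=
  MemLp h p (ell.restrict E)

/-- The Hardy space `H^p`: functions in `L^p` of the circle whose Fourier coefficients of
strictly negative index vanish. -/
def MemHardy (p : ℝ≥0∞) (g : UnitTorus → ℂ) : Prop :=
  MemLp g p ell ∧ ∀ n : ℤ, n < 0 → fourierCoeff g n = 0

/-- The duality product `⟨u, v⟩_E = (1 / 2π) ∫_E u(e^{iθ}) conj(v(e^{iθ})) dθ`. -/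
noncomputable def pairingOn (E : Set UnitTorus) (u v : UnitTorus → ℂ) : ℂ :=
  ∫ x in E, u x * (starRingEnd ℂ) (v x) ∂ell

/-- The function `θ ↦ q(e^{iθ})` on the circle defined by a polynomial `q`. -/
noncomputable def polyTrace (q : Polynomial ℂ) : UnitTorus → ℂ :=
  fun x => q.eval (fourier 1 x : ℂ)

/-- `|g| ≤ 1` almost everywhere on `E`. -/
def BoundedByOneOn (E : Set UnitTorus) (g : UnitTorus → ℂ) : Prop :=
  ∀ᵐ x ∂(ell.restrict E), ‖g x‖ ≤ 1

/-- `I` is a finite union of closed arcs `{e^{iθ} : a j ≤ θ ≤ b j}`. -/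
def IsFiniteUnionOfClosedArcs (I : Set UnitTorus) : Prop :=
  ∃ (N : ℕ) (a b : Fin N → ℝ),
    I = ⋃ j, (fun θ : ℝ => (θ : UnitTorus)) '' Set.Icc (a j) (b j)

/-- `g₀` solves the bounded extremal problem: it is a best approximation of `f` in `L²(I)` among
all `g ∈ H²` such that `|g| ≤ 1` a.e. on the complement `J` of `I`. -/
def IsBEPSolution (I : Set UnitTorus) (f g₀ : UnitTorus → ℂ) : Prop :=
  MemHardy 2 g₀ ∧ BoundedByOneOn Iᶜ g₀ ∧
    ∀ g : UnitTorus → ℂ, MemHardy 2 g → BoundedByOneOn Iᶜ g →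
      lpNormOn 2 I (fun x => f x - g₀ x) ≤ lpNormOn 2 I (fun x => f x - g x)

/-- `k` solves the polynomial bounded extremal problem of degree `n`: it is a best approximation
of `f` in `L²(I)` among all polynomials of degree at most `n` such that `|g| ≤ 1` a.e. on the
complement `J` of `I`. -/
def IsFBEPSolution (I : Set UnitTorus) (f : UnitTorus → ℂ) (n : ℕ) (k : Polynomial ℂ) : Prop :=
  k.natDegree ≤ n ∧ BoundedByOneOn Iᶜ (polyTrace k) ∧
    ∀ q : Polynomial ℂ, q.natDegree ≤ n → BoundedByOneOn Iᶜ (polyTrace q) →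
      lpNormOn 2 I (fun x => f x - polyTrace k x) ≤ lpNormOn 2 I (fun x => f x - polyTrace q x)

end BoundedExtremal

/-!
The problem is a metric projection onto a convex subset of `L²(I)`, so that
`‖g₀ - g‖² ≤ ‖f - g‖² - ‖f - g₀‖²` on `I` for every admissible `g`, and convergence on `I` reduces
to approximating `g₀` by admissible polynomials. Averages over short arcs, truncated in frequency,
provide polynomials and preserve the bound away from the endpoints of `I`. The overshoot near them
is repaired beforehand by the factor `exp (-W)`, with `W ∈ H²` of prescribed real part `≥ 0` and
small norm: `|z| exp (-Re W) ≤ 1` as soon as `|z| ≤ 1 + Re W`.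

On `J` the functions `g₀ - k n ∈ H²` are bounded, and they tend to `0` on `I`. They are orthogonal
to the conjugates of `e^{iθ} q` for every polynomial `q`, and those functions are dense on `J`
because `I` has positive measure: hence the weak-* convergence.

If `|g₀| < 1` on a subset `E` of `J` of positive measure, then polynomials are dense in `L²(Eᶜ)`,
so that, after the same damping, `g₀` can be moved towards `f` on `I` at a negligible cost, and
minimality forces `g₀ = f` on `I`. The hypothesis of part (b) therefore yields `|g₀| = 1` on `J`.
There `|g₀ - k|² ≤ 2 Re ((g₀ - k) conj g₀)` when `|k| ≤ 1`, which turns weak into strong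
convergence.
-/

namespace BoundedExtremal

/-! ### Fourier coefficients -/

section FourierCoefficients

variable {T : ℝ}

lemma norm_fourier_apply (n : ℤ) (x : AddCircle T) : ‖(fourier n x : ℂ)‖ = 1 := by
  rw [fourier_apply, Circle.norm_coe]

lemma fourier_one_pow (n : ℕ) (x : AddCircle T) :
    (fourier 1 x : ℂ) ^ n = fourier (n : ℤ) x := by
  rw [fourier_apply, fourier_apply, one_zsmul, natCast_zsmul, toCircle_nsmul, Circle.coe_pow]

variable [Fact (0 < T)]

lemma fourierCoeff_fourier_mul (g : AddCircle T → ℂ) (m n : ℤ) :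
    fourierCoeff (fun x => fourier m x * g x) n = fourierCoeff g (n - m) := by
  refine integral_congr_ae (ae_of_all _ fun x => ?_)
  simp only [smul_eq_mul]
  rw [← mul_assoc, ← fourier_add, neg_sub, neg_add_eq_sub]

lemma fourierCoeff_conj (g : AddCircle T → ℂ) (n : ℤ) :
    fourierCoeff (fun x => (starRingEnd ℂ) (g x)) n = (starRingEnd ℂ) (fourierCoeff g (-n)) := by
  rw [fourierCoeff, fourierCoeff, ← integral_conj]
  refine integral_congr_ae (ae_of_all _ fun x => ?_)
  simp only [smul_eq_mul, map_mul, neg_neg, fourier_neg]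

lemma fourierCoeff_fun_sub {g h : AddCircle T → ℂ} (hg : Integrable g haarAddCircle)
    (hh : Integrable h haarAddCircle) (n : ℤ) :
    fourierCoeff (fun x => g x - h x) n = fourierCoeff g n - fourierCoeff h n := by
  simp only [fourierCoeff, smul_sub]
  exact integral_sub (hg.fourier_smul (-n)) (hh.fourier_smul (-n))

end FourierCoefficients

instance : IsProbabilityMeasure ell := inferInstanceAs (IsProbabilityMeasure haarAddCircle)

instance : Measure.IsAddHaarMeasure ell :=
  inferInstanceAs (Measure.IsAddHaarMeasure haarAddCircle)

lemma fourierCoeff_eq_integral (g : UnitTorus → ℂ) (n : ℤ) :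
    fourierCoeff g n = ∫ x, fourier (-n) x * g x ∂ell := rfl

lemma fourierCoeff_zero_eq_integral (g : UnitTorus → ℂ) :
    fourierCoeff g 0 = ∫ x, g x ∂ell := by
  simp [fourierCoeff_eq_integral]

lemma toReal_eLpNorm_two_sq {α E : Type*} [MeasurableSpace α] [NormedAddCommGroup E]
    {μ : Measure α} {g : α → E} (hg : MemLp g 2 μ) :
    (eLpNorm g 2 μ).toReal ^ 2 = ∫ x, ‖g x‖ ^ 2 ∂μ := by
  have hnonneg : 0 ≤ ∫ x, ‖g x‖ ^ 2 ∂μ := integral_nonneg fun x => by positivity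
  rw [hg.eLpNorm_eq_integral_rpow_norm two_ne_zero ENNReal.ofNat_ne_top]
  simp only [ENNReal.toReal_ofNat, Real.rpow_two]
  rw [ENNReal.toReal_ofReal (by positivity)]
  exact_mod_cast Real.rpow_inv_natCast_pow hnonneg two_ne_zero

lemma hasSum_sq_norm_fourierCoeff {g : UnitTorus → ℂ} (hg : MemLp g 2 ell) :
    HasSum (fun n => ‖fourierCoeff g n‖ ^ 2) ((eLpNorm g 2 ell).toReal ^ 2) := by
  have hae : (hg.toLp g : UnitTorus → ℂ) =ᵐ[ell] g := hg.coeFn_toLp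
  have parseval : HasSum (fun n => ‖fourierCoeff (hg.toLp g : UnitTorus → ℂ) n‖ ^ 2)
      (∫ x, ‖hg.toLp g x‖ ^ 2 ∂ell) := hasSum_sq_fourierCoeff (hg.toLp g)
  rw [fourierCoeff_congr_ae hae] at parseval
  rwa [← eLpNorm_congr_ae hae, toReal_eLpNorm_two_sq (Lp.memLp _)]

/-- The monomials `fourier n` as a Hilbert basis of `L²` of the circle, with respect to `ell`. -/
noncomputable def ellBasis : HilbertBasis ℤ ℂ (Lp ℂ 2 ell) := fourierBasis

lemma ellBasis_repr (g : Lp ℂ 2 ell) (n : ℤ) : ellBasis.repr g n = fourierCoeff g n :=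
  fourierBasis_repr g n

lemma hasSum_conj_fourierCoeff_mul {u g : UnitTorus → ℂ} (hu : MemLp u 2 ell)
    (hg : MemLp g 2 ell) :
    HasSum (fun n => (starRingEnd ℂ) (fourierCoeff u n) * fourierCoeff g n)
      (∫ x, (starRingEnd ℂ) (u x) * g x ∂ell) := by
  have hu_ae : (hu.toLp u : UnitTorus → ℂ) =ᵐ[ell] u := hu.coeFn_toLp
  have hg_ae : (hg.toLp g : UnitTorus → ℂ) =ᵐ[ell] g := hg.coeFn_toLp
  have inner_eq : inner ℂ (hu.toLp u) (hg.toLp g) = ∫ x, (starRingEnd ℂ) (u x) * g x ∂ell := by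
    rw [L2.inner_def]
    refine integral_congr_ae ?_
    filter_upwards [hu_ae, hg_ae] with x hux hgx
    rw [hux, hgx, RCLike.inner_apply']
  have hcoeff (n : ℤ) : inner ℂ (ellBasis n) (hg.toLp g) = fourierCoeff g n := by
    rw [← ellBasis.repr_apply_apply, ellBasis_repr, congrFun (fourierCoeff_congr_ae hg_ae) n]
  have hcoeff_conj (n : ℤ) :
      inner ℂ (hu.toLp u) (ellBasis n) = (starRingEnd ℂ) (fourierCoeff u n) := by
    rw [← inner_conj_symm, ← ellBasis.repr_apply_apply, ellBasis_repr,
      congrFun (fourierCoeff_congr_ae hu_ae) n]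
  have h := ellBasis.hasSum_inner_mul_inner (hu.toLp u) (hg.toLp g)
  simp only [hcoeff, hcoeff_conj] at h
  rwa [← inner_eq]

lemma ae_eq_zero_of_fourierCoeff_eq_zero {g : UnitTorus → ℂ} (hg : MemLp g 2 ell)
    (h : ∀ n, fourierCoeff g n = 0) : g =ᵐ[ell] 0 := by
  have parseval := hasSum_sq_norm_fourierCoeff hg
  simp only [h, norm_zero, ne_eq, OfNat.ofNat_ne_zero, not_false_eq_true, zero_pow] at parseval
  have norm_eq_zero : (eLpNorm g 2 ell).toReal = 0 := by
    simpa using parseval.unique hasSum_zero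
  rw [ENNReal.toReal_eq_zero_iff, or_iff_left hg.2.ne] at norm_eq_zero
  exact (eLpNorm_eq_zero_iff hg.1 two_ne_zero).1 norm_eq_zero

lemma tendsto_eLpNorm_two_of_fourierCoeff {ι : Type*} {l : Filter ι} {u : ι → UnitTorus → ℂ}
    {bound : ℤ → ℝ} (hu : ∀ i, MemLp (u i) 2 ell) (hbound : Summable fun n => bound n ^ 2)
    (hle : ∀ i n, ‖fourierCoeff (u i) n‖ ≤ bound n)
    (hlim : ∀ n, Tendsto (fun i => fourierCoeff (u i) n) l (𝓝 0)) :
    Tendsto (fun i => eLpNorm (u i) 2 ell) l (𝓝 0) := by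
  have hsum : Tendsto (fun i => ∑' n, ‖fourierCoeff (u i) n‖ ^ 2) l (𝓝 (∑' _ : ℤ, (0 : ℝ))) := by
    refine tendsto_tsum_of_dominated_convergence hbound (fun n => ?_)
      (Eventually.of_forall fun i n => ?_)
    · simpa using (hlim n).norm.pow 2
    · rw [Real.norm_of_nonneg (by positivity)]
      exact pow_le_pow_left₀ (norm_nonneg _) (hle i n) 2
  simp only [(hasSum_sq_norm_fourierCoeff (hu _)).tsum_eq, tsum_zero] at hsum
  rw [← ENNReal.tendsto_toReal_iff (fun i => (hu i).2.ne) ENNReal.zero_ne_top]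
  simpa [Real.sqrt_sq ENNReal.toReal_nonneg] using hsum.sqrt

/-! ### Hardy functions and polynomials -/

lemma memLp_of_continuous {μ : Measure UnitTorus} [IsFiniteMeasure μ] {u : UnitTorus → ℂ}
    (hu : Continuous u) (p : ℝ≥0∞) : MemLp u p μ :=
  hu.memLp_of_hasCompactSupport (HasCompactSupport.of_compactSpace u)

lemma MemHardy.integrable {g : UnitTorus → ℂ} (hg : MemHardy 2 g) : Integrable g ell :=
  hg.1.integrable one_le_two

lemma MemHardy.const_mul {p : ℝ≥0∞} {g : UnitTorus → ℂ} (hg : MemHardy p g) (c : ℂ) :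
    MemHardy p fun x => c * g x :=
  ⟨hg.1.const_mul c, fun n hn => by rw [fourierCoeff.const_mul, hg.2 n hn, mul_zero]⟩

lemma MemHardy.add {g h : UnitTorus → ℂ} (hg : MemHardy 2 g) (hh : MemHardy 2 h) :
    MemHardy 2 fun x => g x + h x :=
  ⟨hg.1.add hh.1, fun n hn =>
    (congrFun (fourierCoeff.add hg.integrable hh.integrable) n).trans <| by
      rw [Pi.add_apply, hg.2 n hn, hh.2 n hn, add_zero]⟩

lemma MemHardy.sub {g h : UnitTorus → ℂ} (hg : MemHardy 2 g) (hh : MemHardy 2 h) :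
    MemHardy 2 fun x => g x - h x :=
  ⟨hg.1.sub hh.1, fun n hn => by
    rw [fourierCoeff_fun_sub hg.integrable hh.integrable, hg.2 n hn, hh.2 n hn, sub_zero]⟩

lemma continuous_polyTrace (q : Polynomial ℂ) : Continuous (polyTrace q) :=
  q.continuous.comp (map_continuous (fourier 1))

lemma polyTrace_eq_sum {q : Polynomial ℂ} {N : ℕ} (hN : q.natDegree < N) :
    polyTrace q = ∑ i ∈ Finset.range N, fun x => q.coeff i * (fourier (i : ℤ) x : ℂ) := by
  ext x
  simp [polyTrace, Polynomial.eval_eq_sum_range' hN, fourier_one_pow, -fourier_apply]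

lemma fourierCoeff_polyTrace (q : Polynomial ℂ) (n : ℤ) :
    fourierCoeff (polyTrace q) n = if 0 ≤ n then q.coeff n.toNat else 0 := by
  rw [polyTrace_eq_sum (q := q) (N := q.natDegree + 1 + n.toNat) (by omega), fourierCoeff.sum,
    Finset.sum_apply]
  swap
  · exact fun i _ => (memLp_of_continuous (by fun_prop) 1).integrable le_rfl
  simp only [fourierCoeff.const_mul, fourierCoeff_fourier]
  split_ifs with hn
  · rw [Finset.sum_eq_single n.toNat]
    · simp [hn]
    · intro i _ hi
      rw [Pi.single_eq_of_ne (by omega), mul_zero]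
    · intro hi
      simp at hi
  · refine Finset.sum_eq_zero fun i _ => ?_
    rw [Pi.single_eq_of_ne (by omega), mul_zero]

lemma memHardy_polyTrace (q : Polynomial ℂ) (p : ℝ≥0∞) : MemHardy p (polyTrace q) :=
  ⟨memLp_of_continuous (continuous_polyTrace q) p, fun n hn => by
    rw [fourierCoeff_polyTrace, if_neg (by omega)]⟩

/-! ### Averages over arcs and approximation by polynomials -/

/-- The average of the monomial `fourier n` over the arc of radius `r` centered at `0`: averaging a
function over arcs of radius `r` multiplies its `n`-th Fourier coefficient by this number. -/
noncomputable def arcMultiplier (r : ℝ) (n : ℤ) : ℂ :=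
  ⨍ y in Metric.ball (0 : UnitTorus) r, (fourier n y : ℂ) ∂ell

lemma arcMultiplier_mem {r : ℝ} (hr : 0 < r) {n : ℤ} {s : Set ℂ} (hs : Convex ℝ s)
    (hc : IsClosed s) (h : ∀ y ∈ Metric.ball (0 : UnitTorus) r, (fourier n y : ℂ) ∈ s) :
    arcMultiplier r n ∈ s :=
  hs.set_average_mem hc (Metric.measure_ball_pos ell 0 hr).ne' (measure_ne_top _ _)
    (ae_restrict_of_forall_mem Metric.isOpen_ball.measurableSet h)
    ((memLp_of_continuous (map_continuous (fourier n)) 1).integrable le_rfl).integrableOn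

lemma norm_arcMultiplier_le {r : ℝ} (hr : 0 < r) (n : ℤ) : ‖arcMultiplier r n‖ ≤ 1 := by
  simpa using arcMultiplier_mem hr (n := n) (convex_closedBall (0 : ℂ) 1)
    Metric.isClosed_closedBall fun y _ => by simp [norm_fourier_apply, -fourier_apply]

lemma tendsto_arcMultiplier (n : ℤ) :
    Tendsto (fun r => arcMultiplier r n) (𝓝[>] 0) (𝓝 1) := by
  refine Metric.nhds_basis_closedBall.tendsto_right_iff.2 fun ε hε => ?_
  have hcont : ContinuousAt (fun y => (fourier n y : ℂ)) (0 : UnitTorus) :=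
    (map_continuous (fourier n)).continuousAt
  obtain ⟨δ, hδ, hclose⟩ := Metric.continuousAt_iff.1 hcont ε hε
  filter_upwards [Ioo_mem_nhdsGT hδ] with r hr
  refine arcMultiplier_mem hr.1 (convex_closedBall 1 ε) Metric.isClosed_closedBall fun y hy => ?_
  have dist_le := (hclose ((Metric.mem_ball.1 hy).trans hr.2)).le
  rwa [fourier_eval_zero] at dist_le

lemma setIntegral_ball_eq_setIntegral_ball_zero {E : Type*} [NormedAddCommGroup E]
    [NormedSpace ℝ E] (u : UnitTorus → E) (x : UnitTorus) (r : ℝ) :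
    ∫ y in Metric.ball x r, u y ∂ell = ∫ y in Metric.ball 0 r, u (x + y) ∂ell := by
  rw [← integral_indicator Metric.isOpen_ball.measurableSet,
    ← integral_indicator Metric.isOpen_ball.measurableSet, ← integral_add_left_eq_self _ x]
  congr 1; ext y
  simp only [Set.indicator, Metric.mem_ball, dist_eq_norm, add_sub_cancel_left, sub_zero]

lemma setAverage_ball_fourier (x : UnitTorus) (r : ℝ) (n : ℤ) :
    ⨍ y in Metric.ball x r, (fourier n y : ℂ) ∂ell = arcMultiplier r n * fourier n x := by
  have measure_ball : ell.real (Metric.ball x r) = ell.real (Metric.ball 0 r) := by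
    simpa using setIntegral_ball_eq_setIntegral_ball_zero (fun _ => (1 : ℝ)) x r
  rw [arcMultiplier, setAverage_eq, setAverage_eq, measure_ball,
    setIntegral_ball_eq_setIntegral_ball_zero]
  simp only [fourier_apply, smul_add, toCircle_add, Circle.coe_mul]
  rw [integral_const_mul, Complex.real_smul, Complex.real_smul]
  ring

lemma hasSum_setAverage_ball {g : UnitTorus → ℂ} (hg : MemLp g 2 ell) (x : UnitTorus) (r : ℝ) :
    HasSum (fun n => fourierCoeff g n * arcMultiplier r n * fourier n x)
      (⨍ y in Metric.ball x r, g y ∂ell) := by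
  have hmeas : MeasurableSet (Metric.ball x r) := Metric.isOpen_ball.measurableSet
  have indicator_mul (v : UnitTorus → ℂ) :
      ∫ y, (Metric.ball x r).indicator (fun _ => (1 : ℂ)) y * v y ∂ell
        = ∫ y in Metric.ball x r, v y ∂ell := by
    rw [← integral_indicator hmeas]
    congr 1; ext y
    by_cases hy : y ∈ Metric.ball x r <;> simp [Set.indicator, hy]
  have conj_indicator (y : UnitTorus) :
      (starRingEnd ℂ) ((Metric.ball x r).indicator (fun _ => (1 : ℂ)) y)
        = (Metric.ball x r).indicator (fun _ => (1 : ℂ)) y := by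
    by_cases hy : y ∈ Metric.ball x r <;> simp [Set.indicator, hy]
  have coeff_indicator (n : ℤ) :
      (starRingEnd ℂ) (fourierCoeff ((Metric.ball x r).indicator fun _ => (1 : ℂ)) n)
        = ∫ y in Metric.ball x r, (fourier n y : ℂ) ∂ell := by
    rw [fourierCoeff_eq_integral, ← integral_conj, ← indicator_mul]
    simp only [map_mul, conj_indicator, fourier_neg, Complex.conj_conj, mul_comm]
  have parseval := (hasSum_conj_fourierCoeff_mul
    (memLp_indicator_const 2 hmeas (1 : ℂ) (Or.inr (measure_ne_top ell _))) hg).const_smul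
    (ell.real (Metric.ball x r))⁻¹
  simp only [conj_indicator, indicator_mul, coeff_indicator, ← setAverage_eq] at parseval
  refine parseval.congr_fun fun n => ?_
  rw [← smul_mul_assoc, ← setAverage_eq, setAverage_ball_fourier]
  ring

/-- The average of `g ∈ H²` over arcs of radius `r`, with its Fourier series truncated to the
degrees less than `N`. -/
noncomputable def arcPolynomial (g : UnitTorus → ℂ) (r : ℝ) (N : ℕ) : Polynomial ℂ :=
  ∑ n ∈ Finset.range N, Polynomial.monomial n (fourierCoeff g n * arcMultiplier r n)

lemma polyTrace_arcPolynomial (g : UnitTorus → ℂ) (r : ℝ) (N : ℕ) (x : UnitTorus) :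
    polyTrace (arcPolynomial g r N) x
      = ∑ n ∈ Finset.range N, fourierCoeff g n * arcMultiplier r n * (fourier (n : ℤ) x : ℂ) := by
  simp [arcPolynomial, polyTrace, Polynomial.eval_finsetSum, fourier_one_pow, -fourier_apply]

lemma coeff_arcPolynomial (g : UnitTorus → ℂ) (r : ℝ) (N n : ℕ) :
    (arcPolynomial g r N).coeff n = if n < N then fourierCoeff g n * arcMultiplier r n else 0 := by
  simp [arcPolynomial, Polynomial.coeff_monomial]

section ArcPolynomial

variable {g : UnitTorus → ℂ} (hg : MemHardy 2 g)
include hg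

lemma MemHardy.hasSum_setAverage_ball (x : UnitTorus) (r : ℝ) :
    HasSum (fun n : ℕ => fourierCoeff g n * arcMultiplier r n * (fourier (n : ℤ) x : ℂ))
      (⨍ y in Metric.ball x r, g y ∂ell) := by
  refine ((Nat.cast_injective (R := ℤ)).hasSum_iff fun n hn => ?_).2
    (BoundedExtremal.hasSum_setAverage_ball hg.1 x r)
  have hneg : n < 0 := by
    by_contra! hn0
    exact hn ⟨n.toNat, Int.toNat_of_nonneg hn0⟩
  rw [hg.2 n hneg, zero_mul, zero_mul]

lemma MemHardy.eventually_norm_arcPolynomial_sub_setAverage_le (r : ℝ) {ε : ℝ} (hε : 0 < ε) :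
    ∀ᶠ N in atTop, ∀ x,
      ‖polyTrace (arcPolynomial g r N) x - ⨍ y in Metric.ball x r, g y ∂ell‖ ≤ ε := by
  let c : ℕ → ℂ := fun n => fourierCoeff g n * arcMultiplier r n
  have norm_term (n : ℕ) (x : UnitTorus) : ‖c n * (fourier (n : ℤ) x : ℂ)‖ = ‖c n‖ := by
    rw [norm_mul, norm_fourier_apply, mul_one]
  have summable_norm : Summable fun n => ‖c n‖ :=
    (hg.hasSum_setAverage_ball 0 r).summable.norm.congr fun n => norm_term n 0
  filter_upwards [(tendsto_sum_nat_add fun n => ‖c n‖).eventually_lt_const hε] with N hN x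
  have hsum := hg.hasSum_setAverage_ball x r
  rw [polyTrace_arcPolynomial, ← hsum.tsum_eq, ← hsum.summable.sum_add_tsum_nat_add N,
    sub_add_cancel_left, norm_neg]
  have tail_norm (n : ℕ) : ‖c (n + N) * (fourier ((n + N : ℕ) : ℤ) x : ℂ)‖ = ‖c (n + N)‖ :=
    norm_term (n + N) x
  refine (norm_tsum_le_tsum_norm ?_).trans ?_
  · simpa only [c, tail_norm] using (summable_nat_add_iff N).2 summable_norm
  · simpa only [c, tail_norm] using hN.le

lemma MemHardy.fourierCoeff_arcPolynomial_sub (r : ℝ) (N : ℕ) (n : ℤ) :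
    fourierCoeff (fun x => polyTrace (arcPolynomial g r N) x - g x) n
      = (if n < N then fourierCoeff g n * arcMultiplier r n else 0) - fourierCoeff g n := by
  rw [fourierCoeff_fun_sub (memHardy_polyTrace _ 2).integrable hg.integrable,
    fourierCoeff_polyTrace, coeff_arcPolynomial]
  rcases lt_or_ge n 0 with hn | hn
  · simp [hg.2 n hn, hn]
  · simp [hn, Int.toNat_of_nonneg hn, Int.toNat_lt hn]

lemma MemHardy.tendsto_arcPolynomial {ι : Type*} {l : Filter ι} {r : ι → ℝ} {N : ι → ℕ}
    (hr : ∀ i, 0 < r i) (hr0 : Tendsto r l (𝓝 0)) (hN : Tendsto N l atTop) :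
    Tendsto (fun i => eLpNorm (fun x => polyTrace (arcPolynomial g (r i) (N i)) x - g x) 2 ell) l
      (𝓝 0) := by
  refine tendsto_eLpNorm_two_of_fourierCoeff (bound := fun n => 2 * ‖fourierCoeff g n‖)
    (fun i => (memHardy_polyTrace _ 2).1.sub hg.1) ?_ (fun i n => ?_) (fun n => ?_)
  · simpa only [mul_pow] using (hasSum_sq_norm_fourierCoeff hg.1).summable.mul_left (2 ^ 2)
  · rw [hg.fourierCoeff_arcPolynomial_sub]
    refine (norm_sub_le _ _).trans ?_
    rw [two_mul ‖fourierCoeff g n‖]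
    gcongr
    split_ifs
    · rw [norm_mul]
      exact mul_le_of_le_one_right (norm_nonneg _) (norm_arcMultiplier_le (hr i) n)
    · simp
  · have hr0' : Tendsto r l (𝓝[>] 0) :=
      tendsto_nhdsWithin_iff.2 ⟨hr0, Eventually.of_forall hr⟩
    have hlim := (((tendsto_arcMultiplier n).comp hr0').const_mul (fourierCoeff g n)).sub_const
      (fourierCoeff g n)
    rw [mul_one, sub_self] at hlim
    refine hlim.congr' ?_
    filter_upwards [(tendsto_natCast_atTop_atTop.comp hN).eventually_gt_atTop n] with i hi
    rw [hg.fourierCoeff_arcPolynomial_sub, if_pos (by simpa using hi), Function.comp_apply]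

theorem MemHardy.exists_polynomial_seq :
    ∃ p : ℕ → Polynomial ℂ,
      Tendsto (fun k => eLpNorm (fun x => polyTrace (p k) x - g x) 2 ell) atTop (𝓝 0) ∧
      ∀ (k : ℕ) (x : UnitTorus),
        ‖polyTrace (p k) x - ⨍ y in Metric.ball x (1 / ((k : ℝ) + 1)), g y ∂ell‖
          ≤ 1 / ((k : ℝ) + 1) := by
  have hr (k : ℕ) : (0 : ℝ) < 1 / ((k : ℝ) + 1) := by positivity
  choose N hkN hN using fun k : ℕ => ((eventually_ge_atTop k).and
    (hg.eventually_norm_arcPolynomial_sub_setAverage_le (1 / ((k : ℝ) + 1)) (hr k))).exists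
  exact ⟨fun k => arcPolynomial g (1 / ((k : ℝ) + 1)) (N k),
    hg.tendsto_arcPolynomial hr tendsto_one_div_add_atTop_nhds_zero_nat
      (tendsto_atTop_mono hkN tendsto_id), hN⟩

end ArcPolynomial

/-! ### Convergence in `L^p` -/

section LpConvergence

variable {α E : Type*} [MeasurableSpace α] {μ : Measure α} [NormedAddCommGroup E]

lemma tendsto_eLpNorm_of_exponent_le [IsProbabilityMeasure μ] {ι : Type*} {l : Filter ι}
    {F : ι → α → E} {p q : ℝ≥0∞} (hpq : p ≤ q) (hF : ∀ i, AEStronglyMeasurable (F i) μ)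
    (h : Tendsto (fun i => eLpNorm (F i) q μ) l (𝓝 0)) :
    Tendsto (fun i => eLpNorm (F i) p μ) l (𝓝 0) :=
  tendsto_of_tendsto_of_tendsto_of_le_of_le tendsto_const_nhds h (fun _ => zero_le)
    fun i => eLpNorm_le_eLpNorm_of_exponent_le hpq (hF i)

lemma unifIntegrable_of_norm_le {ι : Type*} {p : ℝ≥0∞} (hp : 1 ≤ p) (hp' : p ≠ ⊤)
    {F : ι → α → E} {G : α → ℝ} (hG : MemLp G p μ) (hle : ∀ i, ∀ᵐ x ∂μ, ‖F i x‖ ≤ G x) :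
    UnifIntegrable F p μ := by
  intro ε hε
  obtain ⟨δ, hδ, hsmall⟩ := unifIntegrable_const (ι := Unit) hp hp' hG hε
  refine ⟨δ, hδ, fun i s hs hμs => (eLpNorm_mono_ae ?_).trans (hsmall () s hs hμs)⟩
  filter_upwards [hle i] with x hx
  simp only [norm_indicator_eq_indicator_norm]
  exact Set.indicator_le_indicator (hx.trans (le_abs_self _))

variable [IsFiniteMeasure μ]

lemma tendsto_eLpNorm_of_tendstoInMeasure_of_norm_le {p : ℝ≥0∞} (hp : 1 ≤ p) (hp' : p ≠ ⊤)
    {F : ℕ → α → E} {G : α → ℝ} (hF : ∀ n, AEStronglyMeasurable (F n) μ) (hG : MemLp G p μ)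
    (hle : ∀ n, ∀ᵐ x ∂μ, ‖F n x‖ ≤ G x) (hlim : TendstoInMeasure μ F atTop 0) :
    Tendsto (fun n => eLpNorm (F n) p μ) atTop (𝓝 0) := by
  simpa only [sub_zero] using tendsto_Lp_finite_of_tendstoInMeasure hp hp' hF (MemLp.zero (p := p))
    (unifIntegrable_of_norm_le hp hp' hG hle) hlim

lemma tendsto_eLpNorm_of_tendsto_ae_of_norm_le {p : ℝ≥0∞} (hp : 1 ≤ p) (hp' : p ≠ ⊤)
    {F : ℕ → α → E} {G : α → ℝ} (hF : ∀ n, AEStronglyMeasurable (F n) μ) (hG : MemLp G p μ)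
    (hle : ∀ n, ∀ᵐ x ∂μ, ‖F n x‖ ≤ G x) (hlim : ∀ᵐ x ∂μ, Tendsto (fun n => F n x) atTop (𝓝 0)) :
    Tendsto (fun n => eLpNorm (F n) p μ) atTop (𝓝 0) :=
  tendsto_eLpNorm_of_tendstoInMeasure_of_norm_le hp hp' hF hG hle
    (tendstoInMeasure_of_tendsto_ae hF hlim)

end LpConvergence

/-! ### Multiplication by exponentials -/

lemma norm_exp_sub_exp_le {a b : ℂ} {M : ℝ} (ha : a.re ≤ M) (hb : b.re ≤ M) :
    ‖Complex.exp a - Complex.exp b‖ ≤ Real.exp M * ‖a - b‖ := by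
  refine Convex.norm_image_sub_le_of_norm_deriv_le (𝕜 := ℂ) (s := {z : ℂ | z.re ≤ M})
    (fun z _ => Complex.differentiableAt_exp) (fun z hz => ?_) (convex_halfSpace_re_le M) hb ha
  rw [Complex.deriv_exp, Complex.norm_exp]
  exact Real.exp_le_exp.2 hz

lemma norm_mul_exp_sub_mul_exp_le {a b c d : ℂ} {M : ℝ} (hb : b.re ≤ M) (hd : d.re ≤ M) :
    ‖a * Complex.exp b - c * Complex.exp d‖ ≤ Real.exp M * (‖a - c‖ + ‖c * (b - d)‖) := by
  calc ‖a * Complex.exp b - c * Complex.exp d‖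
      = ‖(a - c) * Complex.exp b + c * (Complex.exp b - Complex.exp d)‖ := by ring_nf
    _ ≤ ‖a - c‖ * Real.exp b.re + ‖c‖ * ‖Complex.exp b - Complex.exp d‖ := by
      rw [← Complex.norm_exp, ← norm_mul, ← norm_mul]
      exact norm_add_le _ _
    _ ≤ ‖a - c‖ * Real.exp M + ‖c‖ * (Real.exp M * ‖b - d‖) := by
      gcongr
      exact norm_exp_sub_exp_le hb hd
    _ = Real.exp M * (‖a - c‖ + ‖c * (b - d)‖) := by rw [norm_mul]; ring

section MulExp

variable {α : Type*} [MeasurableSpace α] {μ : Measure α}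

lemma memLp_mul_exp {g h : α → ℂ} {p : ℝ≥0∞} (hg : MemLp g p μ)
    (hh : AEStronglyMeasurable h μ) {C : ℝ} (hC : ∀ᵐ x ∂μ, (h x).re ≤ C) :
    MemLp (fun x => g x * Complex.exp (h x)) p μ := by
  refine hg.of_le_mul (c := Real.exp C)
    (hg.1.mul (Complex.continuous_exp.comp_aestronglyMeasurable hh)) ?_
  filter_upwards [hC] with x hx
  rw [norm_mul, mul_comm, Complex.norm_exp]
  gcongr

variable [IsProbabilityMeasure μ]

lemma eLpNorm_one_mul_exp_sub_mul_exp_le {g h q p : α → ℂ} {M : ℝ} (hg : MemLp g 2 μ)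
    (hh : MemLp h 2 μ) (hq : MemLp q 2 μ) (hp : MemLp p 2 μ) (hhM : ∀ᵐ x ∂μ, (h x).re ≤ M)
    (hpM : ∀ᵐ x ∂μ, (p x).re ≤ M) :
    eLpNorm (fun x => q x * Complex.exp (p x) - g x * Complex.exp (h x)) 1 μ
      ≤ ENNReal.ofReal (Real.exp M) * (eLpNorm (fun x => q x - g x) 2 μ +
        eLpNorm g 2 μ * eLpNorm (fun x => p x - h x) 2 μ) := by
  have meas_qg : AEStronglyMeasurable (fun x => q x - g x) μ := hq.1.sub hg.1
  have meas_ph : AEStronglyMeasurable (fun x => p x - h x) μ := hp.1.sub hh.1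
  calc eLpNorm (fun x => q x * Complex.exp (p x) - g x * Complex.exp (h x)) 1 μ
      ≤ ENNReal.ofReal (Real.exp M) *
          eLpNorm (fun x => ‖q x - g x‖ + ‖(g • fun x => p x - h x) x‖) 1 μ := by
        refine eLpNorm_le_mul_eLpNorm_of_ae_le_mul ?_ 1
        filter_upwards [hhM, hpM] with x hhx hpx
        rw [Real.norm_of_nonneg (by positivity)]
        exact norm_mul_exp_sub_mul_exp_le hpx hhx
    _ ≤ ENNReal.ofReal (Real.exp M) * (eLpNorm (fun x => q x - g x) 1 μ +
          eLpNorm (g • fun x => p x - h x) 1 μ) := by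
        gcongr
        refine (eLpNorm_add_le meas_qg.norm (hg.1.smul meas_ph).norm le_rfl).trans_eq ?_
        rw [eLpNorm_norm, eLpNorm_norm]
    _ ≤ _ := by
        gcongr
        · exact eLpNorm_le_eLpNorm_of_exponent_le one_le_two meas_qg
        · exact eLpNorm_smul_le_mul_eLpNorm meas_ph hg.1

lemma tendsto_eLpNorm_one_mul_exp_sub_mul_exp {ι : Type*} {l : Filter ι} {g h : α → ℂ}
    {q p : ι → α → ℂ} {M : ℝ} (hg : MemLp g 2 μ) (hh : MemLp h 2 μ) (hq : ∀ k, MemLp (q k) 2 μ)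
    (hp : ∀ k, MemLp (p k) 2 μ) (hhM : ∀ᵐ x ∂μ, (h x).re ≤ M)
    (hpM : ∀ k, ∀ᵐ x ∂μ, (p k x).re ≤ M)
    (hqg : Tendsto (fun k => eLpNorm (fun x => q k x - g x) 2 μ) l (𝓝 0))
    (hph : Tendsto (fun k => eLpNorm (fun x => p k x - h x) 2 μ) l (𝓝 0)) :
    Tendsto (fun k => eLpNorm (fun x => q k x * Complex.exp (p k x) - g x * Complex.exp (h x)) 1 μ)
      l (𝓝 0) := by
  have hlim := ENNReal.Tendsto.const_mul (a := ENNReal.ofReal (Real.exp M))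
    (hqg.add (ENNReal.Tendsto.const_mul hph (Or.inr hg.2.ne))) (Or.inr ENNReal.ofReal_ne_top)
  rw [mul_zero, add_zero, mul_zero] at hlim
  exact tendsto_of_tendsto_of_tendsto_of_le_of_le tendsto_const_nhds hlim (fun _ => zero_le)
    fun k => eLpNorm_one_mul_exp_sub_mul_exp_le hg hh (hq k) (hp k) hhM (hpM k)

lemma tendsto_eLpNorm_mul_exp_neg_sub {g : α → ℂ} {W : ℕ → α → ℂ} (hg : MemLp g 2 μ)
    (hW : ∀ n, MemLp (W n) 2 μ) (hre : ∀ n, ∀ᵐ x ∂μ, 0 ≤ (W n x).re)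
    (hlim : Tendsto (fun n => eLpNorm (W n) 2 μ) atTop (𝓝 0)) :
    Tendsto (fun n => eLpNorm (fun x => g x * Complex.exp (-W n x) - g x) 2 μ) atTop (𝓝 0) := by
  have hre_neg (n : ℕ) : ∀ᵐ x ∂μ, (-W n x).re ≤ 0 := (hre n).mono fun x hx => by simpa using hx
  have hmem (n : ℕ) : MemLp (fun x => g x * Complex.exp (-W n x) - g x) 2 μ :=
    (memLp_mul_exp hg (hW n).1.neg (hre_neg n)).sub hg
  have hlim_neg : Tendsto (fun n => eLpNorm (fun x => -W n x) 2 μ) atTop (𝓝 0) :=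
    hlim.congr fun n => (eLpNorm_neg (W n) 2 μ).symm
  have tendsto_one :
      Tendsto (fun n => eLpNorm (fun x => g x * Complex.exp (-W n x) - g x) 1 μ) atTop (𝓝 0) := by
    have h := tendsto_eLpNorm_one_mul_exp_sub_mul_exp (h := fun _ => 0) (q := fun _ => g)
      (p := fun n x => -W n x) (l := atTop) (M := 0) hg MemLp.zero (fun _ => hg)
      (fun n => (hW n).neg) (by simp) hre_neg (by simp)
      (by simpa only [sub_zero] using hlim_neg)
    simpa only [Complex.exp_zero, mul_one] using h
  refine tendsto_eLpNorm_of_tendstoInMeasure_of_norm_le one_le_two ENNReal.ofNat_ne_top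
    (fun n => (hmem n).1) (hg.norm.const_mul 2) (fun n => ?_)
    (tendstoInMeasure_of_tendsto_eLpNorm one_ne_zero (fun n => (hmem n).1)
      aestronglyMeasurable_zero (by simpa using tendsto_one))
  filter_upwards [hre_neg n] with x hx
  refine (norm_sub_le _ _).trans ?_
  rw [norm_mul, Complex.norm_exp, two_mul]
  gcongr
  exact mul_le_of_le_one_right (norm_nonneg _) (Real.exp_le_one_iff.2 hx)

end MulExp

lemma integral_comp_fourier_one {Φ : ℂ → ℂ} (hΦ : Differentiable ℂ Φ) :
    ∫ x : UnitTorus, Φ (fourier 1 x) ∂ell = Φ 0 := by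
  have interval_eq := fourierCoeff_eq_intervalIntegral (T := 2 * π) (fun x => Φ (fourier 1 x)) 0 0
  rw [fourierCoeff_zero_eq_integral] at interval_eq
  rw [interval_eq, ← hΦ.diffContOnCl.circleAverage (c := 0) (R := 1), Real.circleAverage_def,
    zero_add, one_div]
  congr 1
  refine intervalIntegral.integral_congr fun θ _ => ?_
  have hπ : (π : ℂ) ≠ 0 := Complex.ofReal_ne_zero.2 Real.pi_ne_zero
  simp only [neg_zero, fourier_zero, one_smul, circleMap, zero_add, Complex.ofReal_one, one_mul]
  congr 1
  rw [fourier_coe_apply]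
  congr 1
  push_cast
  field_simp

lemma integral_polyTrace_mul_exp (q p : Polynomial ℂ) :
    ∫ x, polyTrace q x * Complex.exp (polyTrace p x) ∂ell
      = (∫ x, polyTrace q x ∂ell) * Complex.exp (∫ x, polyTrace p x ∂ell) := by
  simp only [polyTrace]
  rw [integral_comp_fourier_one q.differentiable, integral_comp_fourier_one p.differentiable]
  exact integral_comp_fourier_one (q.differentiable.mul p.differentiable.cexp)

lemma MemHardy.exists_polynomial_seq_re_le {h : UnitTorus → ℂ} (hh : MemHardy 2 h) {C : ℝ}
    (hC : ∀ᵐ x ∂ell, (h x).re ≤ C) :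
    ∃ p : ℕ → Polynomial ℂ,
      Tendsto (fun k => eLpNorm (fun x => polyTrace (p k) x - h x) 2 ell) atTop (𝓝 0) ∧
      ∀ k x, (polyTrace (p k) x).re ≤ C + 1 := by
  obtain ⟨p, hp, hp_avg⟩ := hh.exists_polynomial_seq
  refine ⟨p, hp, fun k x => ?_⟩
  have hr : (0 : ℝ) < 1 / ((k : ℝ) + 1) := by positivity
  have avg_re_le : (⨍ y in Metric.ball x (1 / ((k : ℝ) + 1)), h y ∂ell).re ≤ C :=
    (convex_halfSpace_re_le C).set_average_mem (isClosed_le Complex.continuous_re continuous_const)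
      (Metric.measure_ball_pos ell x hr).ne' (measure_ne_top _ _) (ae_restrict_of_ae hC)
      hh.integrable.integrableOn
  have re_sub_le := (Complex.re_le_norm _).trans (hp_avg k x)
  rw [Complex.sub_re] at re_sub_le
  linarith [Nat.one_div_le_one_div (α := ℝ) (Nat.zero_le k)]

lemma MemHardy.integral_mul_exp {g h : UnitTorus → ℂ} (hg : MemHardy 2 g) (hh : MemHardy 2 h)
    {C : ℝ} (hC : ∀ᵐ x ∂ell, (h x).re ≤ C) :
    ∫ x, g x * Complex.exp (h x) ∂ell = (∫ x, g x ∂ell) * Complex.exp (∫ x, h x ∂ell) := by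
  obtain ⟨q, hq, -⟩ := hg.exists_polynomial_seq
  obtain ⟨p, hp, hp_re⟩ := hh.exists_polynomial_seq_re_le hC
  have mem (r : Polynomial ℂ) : MemLp (polyTrace r) 2 ell := (memHardy_polyTrace r 2).1
  have tendsto_integral {u : UnitTorus → ℂ} (hu : MemHardy 2 u) {r : ℕ → Polynomial ℂ}
      (hr : Tendsto (fun k => eLpNorm (fun x => polyTrace (r k) x - u x) 2 ell) atTop (𝓝 0)) :
      Tendsto (fun k => ∫ x, polyTrace (r k) x ∂ell) atTop (𝓝 (∫ x, u x ∂ell)) :=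
    tendsto_integral_of_L1' _ hu.1.1
      (Eventually.of_forall fun k => (mem (r k)).integrable one_le_two)
      (tendsto_eLpNorm_of_exponent_le one_le_two (fun k => (mem (r k)).1.sub hu.1.1) hr)
  have tendsto_left : Tendsto (fun k => ∫ x, polyTrace (q k) x * Complex.exp (polyTrace (p k) x)
      ∂ell) atTop (𝓝 (∫ x, g x * Complex.exp (h x) ∂ell)) := by
    refine tendsto_integral_of_L1' _ (memLp_mul_exp hg.1 hh.1.1 hC).1
      (Eventually.of_forall fun k => (memLp_mul_exp (mem (q k)) (mem (p k)).1
        (ae_of_all _ (hp_re k))).integrable one_le_two) ?_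
    exact tendsto_eLpNorm_one_mul_exp_sub_mul_exp hg.1 hh.1 (fun k => mem (q k))
      (fun k => mem (p k)) (hC.mono fun x hx => by linarith) (fun k => ae_of_all _ (hp_re k)) hq hp
  refine tendsto_nhds_unique tendsto_left (((tendsto_integral hg hq).mul
    ((Complex.continuous_exp.tendsto _).comp (tendsto_integral hh hp))).congr fun k => ?_)
  exact (integral_polyTrace_mul_exp (q k) (p k)).symm

lemma MemHardy.fourier_mul {g : UnitTorus → ℂ} {p : ℝ≥0∞} (hg : MemHardy p g) {m : ℤ}
    (hm : 0 ≤ m) : MemHardy p fun x => fourier m x * g x := by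
  refine ⟨hg.1.of_le_mul (c := 1)
    ((map_continuous (fourier m)).aestronglyMeasurable.mul hg.1.1)
    (ae_of_all _ fun x => by rw [norm_mul, norm_fourier_apply]), fun n hn => ?_⟩
  rw [fourierCoeff_fourier_mul, hg.2 _ (by omega)]

lemma MemHardy.mul_exp {g h : UnitTorus → ℂ} (hg : MemHardy 2 g) (hh : MemHardy 2 h)
    {C : ℝ} (hC : ∀ᵐ x ∂ell, (h x).re ≤ C) :
    MemHardy 2 fun x => g x * Complex.exp (h x) := by
  refine ⟨memLp_mul_exp hg.1 hh.1.1 hC, fun n hn => ?_⟩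
  have hint := (hg.fourier_mul (m := -n) (by omega)).integral_mul_exp hh hC
  rw [← fourierCoeff_eq_integral g n, hg.2 n hn, zero_mul] at hint
  simpa only [fourierCoeff_eq_integral, mul_assoc] using hint

lemma MemHardy.mul_exp_neg {g W : UnitTorus → ℂ} (hg : MemHardy 2 g) (hW : MemHardy 2 W)
    (hre : ∀ᵐ x ∂ell, 0 ≤ (W x).re) : MemHardy 2 fun x => g x * Complex.exp (-W x) := by
  have hneg : MemHardy 2 fun x => -W x := by simpa only [neg_one_mul] using hW.const_mul (-1)
  exact hg.mul_exp hneg (C := 0) (hre.mono fun x hx => by simpa using hx)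

/-! ### Prescribing the real part -/

lemma exists_fourierCoeff_eq {a : ℤ → ℂ} (ha : Summable fun n => ‖a n‖ ^ 2) :
    ∃ g : UnitTorus → ℂ, MemLp g 2 ell ∧ ∀ n, fourierCoeff g n = a n := by
  have hmem : Memℓp a 2 := memℓp_gen (by simpa using ha)
  refine ⟨(ellBasis.repr.symm ⟨a, hmem⟩ : Lp ℂ 2 ell), Lp.memLp _, fun n => ?_⟩
  rw [← ellBasis_repr, LinearIsometryEquiv.apply_symm_apply]

lemma eLpNorm_two_le_mul_of_fourierCoeff {u g : UnitTorus → ℂ} {c : ℝ} (hu : MemLp u 2 ell)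
    (hg : MemLp g 2 ell) (hc : 0 ≤ c) (hle : ∀ n, ‖fourierCoeff u n‖ ≤ c * ‖fourierCoeff g n‖) :
    eLpNorm u 2 ell ≤ ENNReal.ofReal c * eLpNorm g 2 ell := by
  have hsq := hasSum_le (fun n => (pow_le_pow_left₀ (norm_nonneg _) (hle n) 2).trans_eq
    (mul_pow _ _ 2)) (hasSum_sq_norm_fourierCoeff hu)
    ((hasSum_sq_norm_fourierCoeff hg).mul_left (c ^ 2))
  rw [← mul_pow] at hsq
  rw [← ENNReal.toReal_le_toReal hu.2.ne (ENNReal.mul_ne_top ENNReal.ofReal_ne_top hg.2.ne),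
    ENNReal.toReal_mul, ENNReal.toReal_ofReal hc]
  exact le_of_sq_le_sq hsq (by positivity)

lemma ae_re_eq_of_fourierCoeff {h : UnitTorus → ℂ} {w : UnitTorus → ℝ} (hh : MemLp h 2 ell)
    (hw : MemLp w 2 ell) (hcoeff : ∀ n, (starRingEnd ℂ) (fourierCoeff h (-n)) + fourierCoeff h n
      = 2 * fourierCoeff (fun x => (w x : ℂ)) n) :
    ∀ᵐ x ∂ell, (h x).re = w x := by
  have hconj : MemLp (fun x => (starRingEnd ℂ) (h x)) 2 ell := hh.star
  have hw2 : MemLp (fun x => 2 * (w x : ℂ)) 2 ell := hw.ofReal.const_mul 2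
  have hadd (n : ℤ) : fourierCoeff (fun x => (starRingEnd ℂ) (h x) + h x) n
      = (starRingEnd ℂ) (fourierCoeff h (-n)) + fourierCoeff h n := by
    rw [← fourierCoeff_conj]
    exact congrFun (fourierCoeff.add (hconj.integrable one_le_two) (hh.integrable one_le_two)) n
  have hzero := ae_eq_zero_of_fourierCoeff_eq_zero ((hconj.add hh).sub hw2) fun n =>
    (fourierCoeff_fun_sub ((hconj.add hh).integrable one_le_two)
      (hw2.integrable one_le_two) n).trans <| by
      rw [fourierCoeff.const_mul, ← hcoeff n, sub_eq_zero]
      exact hadd n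
  filter_upwards [hzero] with x hx
  have hre : (h x).re + (h x).re - 2 * w x = 0 := by simpa using congrArg Complex.re hx
  linarith

theorem exists_memHardy_re_eq {w : UnitTorus → ℝ} (hw : MemLp w 2 ell) :
    ∃ h : UnitTorus → ℂ, MemHardy 2 h ∧ (∀ᵐ x ∂ell, (h x).re = w x) ∧
      ∫ x, h x ∂ell = ∫ x, w x ∂ell ∧ eLpNorm h 2 ell ≤ 2 * eLpNorm w 2 ell := by
  let W : UnitTorus → ℂ := fun x => w x
  have hW : MemLp W 2 ell := hw.ofReal
  have hW_conj (n : ℤ) : (starRingEnd ℂ) (fourierCoeff W (-n)) = fourierCoeff W n := by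
    rw [← fourierCoeff_conj]
    simp only [W, Complex.conj_ofReal]
  let a : ℤ → ℂ := fun n =>
    if n < 0 then 0 else if n = 0 then fourierCoeff W 0 else 2 * fourierCoeff W n
  have ha (n : ℤ) : ‖a n‖ ≤ 2 * ‖fourierCoeff W n‖ := by
    rcases lt_trichotomy n 0 with hn | rfl | hn
    · simp [a, hn]
    · simpa [a] using le_mul_of_one_le_left (norm_nonneg _) one_le_two
    · simp [a, hn.not_gt, hn.ne']
  have ha_re (n : ℤ) : (starRingEnd ℂ) (a (-n)) + a n = 2 * fourierCoeff W n := by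
    rcases lt_trichotomy n 0 with hn | rfl | hn
    · simp [a, hn, hn.ne, hn.not_gt, hW_conj, Complex.conj_ofNat]
    · have := hW_conj 0
      rw [neg_zero] at this
      simp [a, this, two_mul]
    · simp [a, hn, hn.ne', hn.not_gt]
  obtain ⟨h, hh, hcoeff⟩ := exists_fourierCoeff_eq (a := a) <|
    .of_nonneg_of_le (fun _ => by positivity)
      (fun n => (pow_le_pow_left₀ (norm_nonneg _) (ha n) 2).trans_eq (mul_pow _ _ 2))
      ((hasSum_sq_norm_fourierCoeff hW).summable.mul_left _)
  refine ⟨h, ⟨hh, fun n hn => by simp [hcoeff, a, hn]⟩,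
    ae_re_eq_of_fourierCoeff hh hw fun n => by rw [hcoeff, hcoeff, ha_re], ?_, ?_⟩
  · rw [← fourierCoeff_zero_eq_integral, hcoeff]
    simpa [a, fourierCoeff_zero_eq_integral] using integral_ofReal (f := w) (μ := ell) (𝕜 := ℂ)
  · refine (eLpNorm_two_le_mul_of_fourierCoeff hh hW zero_le_two fun n => ?_).trans_eq ?_
    · rw [hcoeff]
      exact ha n
    · rw [ENNReal.ofReal_ofNat]
      congr 1
      exact eLpNorm_congr_norm_ae (ae_of_all _ fun x => Complex.norm_real _)

/-! ### Polynomial approximation under the constraint -/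

lemma tendsto_eLpNorm_smul_sub {α ι : Type*} [MeasurableSpace α] {μ : Measure α} {l : Filter ι}
    {u : ι → α → ℂ} {g : α → ℂ} {c : ι → ℝ} (hu : ∀ k, MemLp (u k) 2 μ) (hg : MemLp g 2 μ)
    (hlim : Tendsto (fun k => eLpNorm (fun x => u k x - g x) 2 μ) l (𝓝 0))
    (hc : Tendsto c l (𝓝 1)) :
    Tendsto (fun k => eLpNorm (fun x => c k * u k x - g x) 2 μ) l (𝓝 0) := by
  have hbound := (ENNReal.Tendsto.mul hc.enorm (Or.inr ENNReal.zero_ne_top) hlim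
    (Or.inr (by simp))).add (ENNReal.Tendsto.mul_const (hc.sub_const 1).enorm (Or.inr hg.2.ne))
  rw [sub_self, enorm_zero, mul_zero, zero_mul, add_zero] at hbound
  refine tendsto_of_tendsto_of_tendsto_of_le_of_le tendsto_const_nhds hbound (fun _ => zero_le)
    fun k => ?_
  have hsplit : (fun x => c k * u k x - g x)
      = (c k • fun x => u k x - g x) + (c k - 1) • g := by
    ext x
    simp only [Pi.add_apply, Pi.smul_apply, Complex.real_smul]
    push_cast
    ring
  simp only [← eLpNorm_const_smul]
  rw [hsplit]
  exact eLpNorm_add_le (((hu k).1.sub hg.1).const_smul _) (hg.1.const_smul _) one_le_two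

lemma polyTrace_C_mul (c : ℂ) (q : Polynomial ℂ) (x : UnitTorus) :
    polyTrace (Polynomial.C c * q) x = c * polyTrace q x := by
  simp only [polyTrace, Polynomial.eval_mul, Polynomial.eval_C]

lemma norm_setAverage_ball_le_one {g : UnitTorus → ℂ} (hg : Integrable g ell) {x : UnitTorus}
    {r : ℝ} (hr : 0 < r) (hb : ∀ᵐ y ∂ell, y ∈ Metric.ball x r → ‖g y‖ ≤ 1) :
    ‖⨍ y in Metric.ball x r, g y ∂ell‖ ≤ 1 := by
  rw [← mem_closedBall_zero_iff]
  refine (convex_closedBall (0 : ℂ) 1).set_average_mem Metric.isClosed_closedBall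
    (Metric.measure_ball_pos ell x hr).ne' (measure_ne_top _ _) ?_ hg.integrableOn
  simpa only [ae_restrict_iff' Metric.isOpen_ball.measurableSet, mem_closedBall_zero_iff] using hb

lemma MemHardy.exists_polynomial_of_bounded_thickening {J : Set UnitTorus} {δ : ℝ} (hδ : 0 < δ)
    {g : UnitTorus → ℂ} (hg : MemHardy 2 g)
    (hb : ∀ᵐ x ∂ell, x ∈ Metric.thickening δ J → ‖g x‖ ≤ 1) {ε : ℝ≥0∞} (hε : 0 < ε) :
    ∃ q : Polynomial ℂ, (∀ x ∈ J, ‖polyTrace q x‖ ≤ 1) ∧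
      eLpNorm (fun x => polyTrace q x - g x) 2 ell < ε := by
  obtain ⟨p, hp, hp_avg⟩ := hg.exists_polynomial_seq
  have hradius : Tendsto (fun k : ℕ => 1 / ((k : ℝ) + 1)) atTop (𝓝 0) :=
    tendsto_one_div_add_atTop_nhds_zero_nat
  have hscale : Tendsto (fun k : ℕ => (1 + 1 / ((k : ℝ) + 1))⁻¹) atTop (𝓝 1) := by
    simpa using (hradius.const_add 1).inv₀ (by simp)
  have hscaled := tendsto_eLpNorm_smul_sub (fun k => (memHardy_polyTrace (p k) 2).1) hg.1 hp hscale
  obtain ⟨k, hkε, hkδ⟩ := ((hscaled.eventually (gt_mem_nhds hε)).and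
    (hradius.eventually (gt_mem_nhds hδ))).exists
  have hr : (0 : ℝ) < 1 / ((k : ℝ) + 1) := by positivity
  refine ⟨Polynomial.C (((1 + 1 / ((k : ℝ) + 1))⁻¹ : ℝ) : ℂ) * p k, fun x hx => ?_,
    by simpa only [polyTrace_C_mul] using hkε⟩
  have havg := norm_setAverage_ball_le_one hg.integrable hr <| hb.mono fun y hy hyx =>
    hy (Metric.mem_thickening_iff.2 ⟨x, hx, (Metric.mem_ball.1 hyx).trans hkδ⟩)
  have hpx : ‖polyTrace (p k) x‖ ≤ 1 + 1 / ((k : ℝ) + 1) :=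
    (norm_le_insert' _ _).trans (add_le_add havg (hp_avg k x))
  rw [polyTrace_C_mul, norm_mul, Complex.norm_real, Real.norm_of_nonneg (by positivity)]
  exact inv_mul_le_one_of_le₀ hpx (by positivity)

lemma tendsto_eLpNorm_indicator_thickening_diff {J : Set UnitTorus} (hJ : MeasurableSet J)
    (hJ0 : ell (closure J \ J) = 0) {w : UnitTorus → ℝ} (hw : MemLp w 2 ell) :
    Tendsto (fun m : ℕ => eLpNorm ((Metric.thickening (1 / ((m : ℝ) + 1)) J \ J).indicator w) 2 ell)
      atTop (𝓝 0) := by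
  refine tendsto_eLpNorm_of_tendsto_ae_of_norm_le one_le_two ENNReal.ofNat_ne_top
    (fun m => hw.1.indicator (Metric.isOpen_thickening.measurableSet.diff hJ)) hw.norm
    (fun m => ae_of_all _ fun x => norm_indicator_le_norm_self _ _) ?_
  filter_upwards [measure_eq_zero_iff_ae_notMem.1 hJ0] with x hx
  refine tendsto_const_nhds.congr' ?_
  by_cases hxJ : x ∈ closure J
  · exact Eventually.of_forall fun m =>
      (Set.indicator_of_notMem (fun hmem => hx ⟨hxJ, hmem.2⟩) w).symm
  · rw [Metric.closure_eq_iInter_thickening] at hxJ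
    simp only [Set.mem_iInter, not_forall] at hxJ
    obtain ⟨η, hη, hxη⟩ := hxJ
    filter_upwards [tendsto_one_div_add_atTop_nhds_zero_nat.eventually (gt_mem_nhds hη)] with m hm
    exact (Set.indicator_of_notMem
      (fun hmem => hxη (Metric.thickening_mono hm.le J hmem.1)) w).symm

lemma norm_mul_exp_neg_le_one {z W : ℂ} (h : ‖z‖ ≤ 1 + W.re) : ‖z * Complex.exp (-W)‖ ≤ 1 := by
  rw [norm_mul, Complex.norm_exp, Complex.neg_re, Real.exp_neg, ← div_eq_mul_inv,
    div_le_one (Real.exp_pos _)]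
  linarith [Real.add_one_le_exp W.re]

theorem MemHardy.exists_polynomial_bounded {J : Set UnitTorus} (hJ : MeasurableSet J)
    (hJ0 : ell (closure J \ J) = 0) {g : UnitTorus → ℂ} (hg : MemHardy 2 g)
    (hb : BoundedByOneOn J g) {ε : ℝ≥0∞} (hε : 0 < ε) :
    ∃ q : Polynomial ℂ, (∀ x ∈ J, ‖polyTrace q x‖ ≤ 1) ∧
      eLpNorm (fun x => polyTrace q x - g x) 2 ell < ε := by
  let S (m : ℕ) : Set UnitTorus := Metric.thickening (1 / ((m : ℝ) + 1)) J \ J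
  let w (m : ℕ) : UnitTorus → ℝ := (S m).indicator fun x => ‖g x‖
  have hw (m : ℕ) : MemLp (w m) 2 ell :=
    hg.1.norm.indicator (Metric.isOpen_thickening.measurableSet.diff hJ)
  have hw_nonneg (m : ℕ) (x : UnitTorus) : 0 ≤ w m x :=
    Set.indicator_nonneg (fun _ _ => norm_nonneg _) x
  choose W hW hre _ hnorm using fun m => exists_memHardy_re_eq (hw m)
  have hre_nonneg (m : ℕ) : ∀ᵐ x ∂ell, 0 ≤ (W m x).re :=
    (hre m).mono fun x hx => hx ▸ hw_nonneg m x
  have hWlim : Tendsto (fun m => eLpNorm (W m) 2 ell) atTop (𝓝 0) := by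
    have hwlim := ENNReal.Tendsto.const_mul (a := 2)
      (tendsto_eLpNorm_indicator_thickening_diff hJ hJ0 hg.1.norm) (Or.inr (by simp))
    rw [mul_zero] at hwlim
    exact tendsto_of_tendsto_of_tendsto_of_le_of_le tendsto_const_nhds hwlim (fun _ => zero_le)
      hnorm
  have hlim := tendsto_eLpNorm_mul_exp_neg_sub hg.1 (fun m => (hW m).1) hre_nonneg hWlim
  obtain ⟨m, hm⟩ := (hlim.eventually (gt_mem_nhds (ENNReal.half_pos hε.ne'))).exists
  have hG : MemHardy 2 fun x => g x * Complex.exp (-W m x) := hg.mul_exp_neg (hW m) (hre_nonneg m)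
  have hGb : ∀ᵐ x ∂ell, x ∈ Metric.thickening (1 / ((m : ℝ) + 1)) J →
      ‖g x * Complex.exp (-W m x)‖ ≤ 1 := by
    filter_upwards [hre m, (ae_restrict_iff' hJ).1 hb] with x hWx hgx hx
    refine norm_mul_exp_neg_le_one ?_
    rw [hWx]
    by_cases hxJ : x ∈ J
    · linarith [hgx hxJ, hw_nonneg m x]
    · rw [show w m x = ‖g x‖ from Set.indicator_of_mem (s := S m) ⟨hx, hxJ⟩ _]
      linarith
  obtain ⟨q, hqJ, hq⟩ := hG.exists_polynomial_of_bounded_thickening (by positivity) hGb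
    (ENNReal.half_pos hε.ne')
  refine ⟨q, hqJ, ?_⟩
  rw [← ENNReal.add_halves ε]
  refine lt_of_eq_of_lt (congrArg (eLpNorm · 2 ell) (funext fun x => ?_)) ((eLpNorm_add_le
    ((memHardy_polyTrace q 2).1.1.sub hG.1.1) (hG.1.1.sub hg.1.1) one_le_two).trans_lt
    (ENNReal.add_lt_add hq hm))
  exact (sub_add_sub_cancel _ _ _).symm

/-! ### Uniqueness and density on sets of positive measure -/

lemma MemHardy.norm_integral_mul_exp_le {E : Set UnitTorus} (hE : MeasurableSet E)
    {g : UnitTorus → ℂ} (hg : MemHardy 2 g) (hzero : ∀ᵐ x ∂ell, x ∈ E → g x = 0) {c : ℝ}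
    (hc : 0 ≤ c) :
    ‖∫ x, g x ∂ell‖ * Real.exp (c * ell.real E) ≤ ∫ x, ‖g x‖ ∂ell := by
  obtain ⟨h, hh, hre, hint, -⟩ := exists_memHardy_re_eq
    (memLp_indicator_const 2 hE c (Or.inr (measure_ne_top ell E)))
  have hre_le : ∀ᵐ x ∂ell, (h x).re ≤ c := hre.mono fun x hx =>
    hx.trans_le (Set.indicator_le_self' (fun _ _ => hc) x)
  have hexp := hg.integral_mul_exp hh hre_le
  rw [hint, integral_indicator_const _ hE, smul_eq_mul, mul_comm _ c] at hexp
  rw [← Complex.norm_exp_ofReal, ← norm_mul, ← hexp]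
  refine (norm_integral_le_integral_norm _).trans_eq (integral_congr_ae ?_)
  filter_upwards [hzero, hre] with x hx hrex
  by_cases hxE : x ∈ E
  · simp [hx hxE]
  · rw [norm_mul, Complex.norm_exp, hrex, Set.indicator_of_notMem hxE, Real.exp_zero, mul_one]

lemma MemHardy.integral_eq_zero_of_ae_eq_zero_on {E : Set UnitTorus} (hE : MeasurableSet E)
    (hE0 : ell E ≠ 0) {g : UnitTorus → ℂ} (hg : MemHardy 2 g)
    (hzero : ∀ᵐ x ∂ell, x ∈ E → g x = 0) :
    ∫ x, g x ∂ell = 0 := by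
  by_contra hne
  have hpos : 0 < ell.real E := ENNReal.toReal_pos hE0 (measure_ne_top _ _)
  have hlim : Tendsto (fun c : ℝ => ‖∫ x, g x ∂ell‖ * Real.exp (c * ell.real E)) atTop atTop :=
    (Real.tendsto_exp_atTop.comp (tendsto_id.atTop_mul_const hpos)).const_mul_atTop
      (norm_pos_iff.2 hne)
  obtain ⟨c, hlt, hc⟩ := ((hlim.eventually_gt_atTop (∫ x, ‖g x‖ ∂ell)).and
    (eventually_ge_atTop 0)).exists
  exact hlt.not_ge (hg.norm_integral_mul_exp_le hE hzero hc)

lemma MemHardy.fourier_neg_mul_of_ae_eq_zero_on {E : Set UnitTorus} (hE : MeasurableSet E)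
    (hE0 : ell E ≠ 0) {g : UnitTorus → ℂ} (hg : MemHardy 2 g)
    (hzero : ∀ᵐ x ∂ell, x ∈ E → g x = 0) (n : ℕ) :
    MemHardy 2 fun x => fourier (-n : ℤ) x * g x := by
  induction n with
  | zero => simpa using hg
  | succ n ih =>
    refine ⟨hg.1.of_le_mul (c := 1) ((map_continuous _).aestronglyMeasurable.mul hg.1.1)
      (ae_of_all _ fun x => by rw [norm_mul, norm_fourier_apply]), fun m hm => ?_⟩
    have hshift : fourierCoeff (fun x => fourier (-(n + 1 : ℕ) : ℤ) x * g x) m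
        = fourierCoeff (fun x => fourier (-n : ℤ) x * g x) (m + 1) := by
      rw [fourierCoeff_fourier_mul, fourierCoeff_fourier_mul]
      congr 1
      push_cast
      ring
    rw [hshift]
    rcases (show m + 1 < 0 ∨ m + 1 = 0 by omega) with hneg | heq
    · exact ih.2 _ hneg
    · rw [heq, fourierCoeff_zero_eq_integral]
      exact ih.integral_eq_zero_of_ae_eq_zero_on hE hE0
        (hzero.mono fun x hx hxE => by rw [hx hxE, mul_zero])

theorem MemHardy.ae_eq_zero_of_ae_eq_zero_on {E : Set UnitTorus} (hE : MeasurableSet E)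
    (hE0 : ell E ≠ 0) {g : UnitTorus → ℂ} (hg : MemHardy 2 g)
    (hzero : ∀ᵐ x ∂ell, x ∈ E → g x = 0) : g =ᵐ[ell] 0 := by
  refine ae_eq_zero_of_fourierCoeff_eq_zero hg.1 fun n => ?_
  rcases lt_or_ge n 0 with hn | hn
  · exact hg.2 n hn
  · lift n to ℕ using hn
    rw [fourierCoeff_eq_integral]
    exact (hg.fourier_neg_mul_of_ae_eq_zero_on hE hE0 hzero n).integral_eq_zero_of_ae_eq_zero_on
      hE hE0 (hzero.mono fun x hx hxE => by rw [hx hxE, mul_zero])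

/-- The map sending a polynomial to the class in `L²(μ)` of its values on the circle. -/
noncomputable def polyTraceLp (μ : Measure UnitTorus) [IsFiniteMeasure μ] :
    Polynomial ℂ →ₗ[ℂ] Lp ℂ 2 μ where
  toFun q := (memLp_of_continuous (continuous_polyTrace q) 2).toLp (polyTrace q)
  map_add' p q := by
    rw [← MemLp.toLp_add]
    congr 1
    ext x
    simp [polyTrace]
  map_smul' c q := by
    rw [RingHom.id_apply, ← MemLp.toLp_const_smul]
    congr 1
    ext x
    simp [polyTrace]

lemma coeFn_polyTraceLp (μ : Measure UnitTorus) [IsFiniteMeasure μ] (q : Polynomial ℂ) :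
    polyTraceLp μ q =ᵐ[μ] polyTrace q :=
  (memLp_of_continuous (continuous_polyTrace q) 2).coeFn_toLp

lemma integral_fourier_mul_conj_eq_zero {μ : Measure UnitTorus} [IsFiniteMeasure μ] {v : Lp ℂ 2 μ}
    (hv : v ∈ (LinearMap.range (polyTraceLp μ))ᗮ) (n : ℕ) :
    ∫ x, fourier (n : ℤ) x * (starRingEnd ℂ) (v x) ∂μ = 0 := by
  have hinner := (Submodule.mem_orthogonal' _ v).1 hv _
    (LinearMap.mem_range_self (polyTraceLp μ) (Polynomial.X ^ n))
  rw [L2.inner_def] at hinner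
  rw [← hinner]
  refine integral_congr_ae ?_
  filter_upwards [coeFn_polyTraceLp μ (Polynomial.X ^ n)] with x hx
  rw [hx, RCLike.inner_apply', polyTrace, Polynomial.eval_pow, Polynomial.eval_X, fourier_one_pow]
  ring

lemma topologicalClosure_range_polyTraceLp_restrict_compl {E : Set UnitTorus}
    (hE : MeasurableSet E) (hE0 : ell E ≠ 0) :
    (LinearMap.range (polyTraceLp (ell.restrict Eᶜ))).topologicalClosure = ⊤ := by
  rw [Submodule.topologicalClosure_eq_top_iff, Submodule.eq_bot_iff]
  intro v hv
  let u : UnitTorus → ℂ := Eᶜ.indicator fun x => (starRingEnd ℂ) (v x)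
  have hu : MemHardy 2 u := by
    refine ⟨(memLp_indicator_iff_restrict hE.compl).2 (Lp.memLp v).star, fun n hn => ?_⟩
    rw [fourierCoeff_eq_integral]
    simp only [u, ← Set.indicator_mul_right]
    rw [integral_indicator hE.compl, ← Int.toNat_of_nonneg (neg_nonneg.2 hn.le)]
    exact integral_fourier_mul_conj_eq_zero hv _
  have hu0 := hu.ae_eq_zero_of_ae_eq_zero_on hE hE0 <| ae_of_all _ fun x hx =>
    Set.indicator_of_notMem (by simpa using hx) _
  rw [Lp.eq_zero_iff_ae_eq_zero, Filter.EventuallyEq, ae_restrict_iff' hE.compl]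
  filter_upwards [hu0] with x hx hxE
  rwa [show u x = _ from Set.indicator_of_mem hxE _, Pi.zero_apply, map_eq_zero] at hx

theorem exists_polynomial_eLpNorm_two_sub_lt {E : Set UnitTorus} (hE : MeasurableSet E)
    (hE0 : ell E ≠ 0) {u : UnitTorus → ℂ} (hu : MemLp u 2 (ell.restrict Eᶜ)) {ε : ℝ≥0∞}
    (hε : 0 < ε) :
    ∃ q : Polynomial ℂ, eLpNorm (fun x => polyTrace q x - u x) 2 (ell.restrict Eᶜ) < ε := by
  have hdense : hu.toLp u ∈ closure (LinearMap.range (polyTraceLp (ell.restrict Eᶜ)) : Set _) := by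
    rw [← Submodule.topologicalClosure_coe,
      topologicalClosure_range_polyTraceLp_restrict_compl hE hE0]
    trivial
  obtain ⟨_, ⟨q, rfl⟩, hq⟩ := EMetric.mem_closure_iff.1 hdense ε hε
  refine ⟨q, ?_⟩
  rwa [edist_comm, polyTraceLp, LinearMap.coe_mk, AddHom.coe_mk, Lp.edist_toLp_toLp] at hq

lemma eLpNorm_one_restrict_le_eLpNorm_two {S : Set UnitTorus} (hS : MeasurableSet S)
    {u : UnitTorus → ℂ} (hu : AEStronglyMeasurable u (ell.restrict S)) :
    eLpNorm u 1 (ell.restrict S) ≤ eLpNorm u 2 (ell.restrict S) := by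
  rw [← eLpNorm_indicator_eq_eLpNorm_restrict hS, ← eLpNorm_indicator_eq_eLpNorm_restrict hS]
  exact eLpNorm_le_eLpNorm_of_exponent_le one_le_two
    ((aestronglyMeasurable_indicator_iff hS).2 hu)

theorem exists_polynomial_eLpNorm_one_sub_lt {E : Set UnitTorus} (hE : MeasurableSet E)
    (hE0 : ell E ≠ 0) {h : UnitTorus → ℂ} (hh : MemLp h 1 (ell.restrict Eᶜ)) {ε : ℝ≥0∞}
    (hε : 0 < ε) :
    ∃ q : Polynomial ℂ,
      eLpNorm (fun x => fourier 1 x * polyTrace q x - h x) 1 (ell.restrict Eᶜ) < ε := by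
  obtain ⟨u, hhu, hu⟩ := hh.exists_boundedContinuous_eLpNorm_sub_le ENNReal.one_ne_top
    (ENNReal.half_pos hε.ne').ne'
  obtain ⟨q, hq⟩ := exists_polynomial_eLpNorm_two_sub_lt hE hE0
    (memLp_of_continuous ((map_continuous (fourier (-1))).mul u.continuous) 2)
    (ENNReal.half_pos hε.ne')
  have hcont : Continuous fun x => fourier 1 x * polyTrace q x :=
    (map_continuous (fourier 1)).mul (continuous_polyTrace q)
  have hqu : eLpNorm (fun x => fourier 1 x * polyTrace q x - u x) 1 (ell.restrict Eᶜ) < ε / 2 := by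
    refine ((eLpNorm_one_restrict_le_eLpNorm_two hE.compl
      (hcont.sub u.continuous).aestronglyMeasurable).trans_eq
      (eLpNorm_congr_norm_ae (ae_of_all _ fun x => ?_))).trans_lt hq
    rw [← one_mul ‖polyTrace q x - _‖, ← norm_fourier_apply 1 x, ← norm_mul, mul_sub, Pi.mul_apply,
      ← mul_assoc, ← fourier_add, add_neg_cancel, fourier_zero, one_mul,
      Pi.sub_apply]
  refine ⟨q, ?_⟩
  rw [← ENNReal.add_halves ε]
  refine lt_of_eq_of_lt (congrArg (eLpNorm · 1 _) (funext fun x => ?_)) ((eLpNorm_sub_le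
    (hcont.sub u.continuous).aestronglyMeasurable
    (hh.1.sub u.continuous.aestronglyMeasurable) le_rfl).trans_lt
    (ENNReal.add_lt_add_of_lt_of_le (hh.sub hu).2.ne hqu hhu))
  simp

/-! ### Weak-* convergence -/

lemma tendsto_integral_mul_of_dense {α : Type*} [MeasurableSpace α] {μ : Measure α}
    {d : ℕ → α → ℂ} {C : ℝ} (hd : ∀ n, AEStronglyMeasurable (d n) μ)
    (hC : ∀ n, ∀ᵐ x ∂μ, ‖d n x‖ ≤ C) {h : α → ℂ} (hh : Integrable h μ)
    (happrox : ∀ ε : ℝ≥0∞, 0 < ε → ∃ ψ : α → ℂ, Integrable ψ μ ∧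
      eLpNorm (fun x => ψ x - h x) 1 μ < ε ∧
      Tendsto (fun n => ∫ x, d n x * ψ x ∂μ) atTop (𝓝 0)) :
    Tendsto (fun n => ∫ x, d n x * h x ∂μ) atTop (𝓝 0) := by
  rw [Metric.tendsto_atTop']
  intro ε hε
  have hM : 0 < |C| + 1 := by positivity
  obtain ⟨ψ, hψ, hψh, hψlim⟩ := happrox (ENNReal.ofReal (ε / 2 / (|C| + 1)))
    (ENNReal.ofReal_pos.2 (by positivity))
  obtain ⟨N, hN⟩ := Metric.tendsto_atTop'.1 hψlim (ε / 2) (by positivity)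
  refine ⟨N, fun n hn => ?_⟩
  have hsub : ‖∫ x, d n x * h x ∂μ - ∫ x, d n x * ψ x ∂μ‖ ≤ |C| * ∫ x, ‖ψ x - h x‖ ∂μ := by
    rw [← integral_sub (hh.bdd_mul (hd n) (hC n)) (hψ.bdd_mul (hd n) (hC n)),
      ← integral_const_mul]
    refine norm_integral_le_of_norm_le ((hψ.sub hh).norm.const_mul _) ?_
    filter_upwards [hC n] with x hx
    rw [← mul_sub, norm_mul, norm_sub_rev]
    gcongr
    exact hx.trans (le_abs_self C)
  have hL1 : ∫ x, ‖ψ x - h x‖ ∂μ < ε / 2 / (|C| + 1) := by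
    rw [integral_norm_eq_lintegral_enorm (f := fun x => ψ x - h x) (hψ.1.sub hh.1),
      ← eLpNorm_one_eq_lintegral_enorm]
    exact (ENNReal.lt_ofReal_iff_toReal_lt hψh.ne_top).1 hψh
  have hsmall : |C| * ∫ x, ‖ψ x - h x‖ ∂μ ≤ ε / 2 :=
    calc |C| * ∫ x, ‖ψ x - h x‖ ∂μ ≤ (|C| + 1) * (ε / 2 / (|C| + 1)) := by
          gcongr
          linarith
      _ = ε / 2 := mul_div_cancel₀ _ hM.ne'
  have hψn := hN n hn
  rw [dist_zero_right] at hψn ⊢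
  linarith [norm_sub_norm_le (∫ x, d n x * h x ∂μ) (∫ x, d n x * ψ x ∂μ)]

lemma MemHardy.integral_mul_fourier_one_mul_polyTrace {g : UnitTorus → ℂ} (hg : MemHardy 2 g)
    (q : Polynomial ℂ) : ∫ x, g x * (fourier 1 x * polyTrace q x) ∂ell = 0 := by
  have hterm (i : ℕ) : Integrable (fun x => q.coeff i * (fourier (i + 1 : ℤ) x * g x)) ell :=
    ((hg.fourier_mul (by positivity)).integrable).const_mul _
  have hexpand (x : UnitTorus) : g x * (fourier 1 x * polyTrace q x)
      = ∑ i ∈ Finset.range (q.natDegree + 1), q.coeff i * (fourier (i + 1 : ℤ) x * g x) := by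
    rw [polyTrace_eq_sum q.natDegree.lt_succ_self, Finset.sum_apply, Finset.mul_sum,
      Finset.mul_sum]
    refine Finset.sum_congr rfl fun i _ => ?_
    rw [fourier_add]
    ring
  simp only [hexpand]
  rw [integral_finsetSum _ fun i _ => hterm i]
  refine Finset.sum_eq_zero fun i _ => ?_
  have hcoeff := hg.2 (-(i + 1)) (by omega)
  rw [fourierCoeff_eq_integral, neg_neg] at hcoeff
  rw [integral_const_mul, hcoeff, mul_zero]

lemma MemHardy.tendsto_setIntegral_compl_mul_fourier_one_mul_polyTrace {I : Set UnitTorus}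
    (hI : MeasurableSet I) {d : ℕ → UnitTorus → ℂ} (hd : ∀ n, MemHardy 2 (d n))
    (hlim : Tendsto (fun n => lpNormOn 2 I (d n)) atTop (𝓝 0)) (q : Polynomial ℂ) :
    Tendsto (fun n => ∫ x in Iᶜ, d n x * (fourier 1 x * polyTrace q x) ∂ell) atTop (𝓝 0) := by
  have hcont : Continuous fun x => fourier 1 x * polyTrace q x :=
    (map_continuous (fourier 1)).mul (continuous_polyTrace q)
  have hint (n : ℕ) : Integrable (fun x => d n x * (fourier 1 x * polyTrace q x)) ell :=
    (hd n).1.integrable_mul (memLp_of_continuous hcont 2)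
  have hcompl (n : ℕ) : ∫ x in Iᶜ, d n x * (fourier 1 x * polyTrace q x) ∂ell
      = -∫ x in I, d n x * (fourier 1 x * polyTrace q x) ∂ell := by
    rw [eq_neg_iff_add_eq_zero, add_comm, integral_add_compl hI (hint n),
      (hd n).integral_mul_fourier_one_mul_polyTrace q]
  have hL1 : Tendsto (fun n => eLpNorm (fun x => d n x * (fourier 1 x * polyTrace q x)) 1
      (ell.restrict I)) atTop (𝓝 0) := by
    have hle (n : ℕ) : eLpNorm (fun x => d n x * (fourier 1 x * polyTrace q x)) 1 (ell.restrict I)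
        ≤ lpNormOn 2 I (d n) * lpNormOn 2 I (fun x => fourier 1 x * polyTrace q x) :=
      eLpNorm_smul_le_mul_eLpNorm (φ := d n) (p := 2) (q := 2) hcont.aestronglyMeasurable
        (hd n).1.1.restrict
    have hbound := ENNReal.Tendsto.mul_const hlim
      (Or.inr (memLp_of_continuous (μ := ell.restrict I) hcont 2).2.ne)
    rw [zero_mul] at hbound
    exact tendsto_of_tendsto_of_tendsto_of_le_of_le tendsto_const_nhds hbound (fun _ => zero_le) hle
  have hI_lim := tendsto_integral_of_L1' (f := 0) (μ := ell.restrict I) (l := atTop)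
    (F := fun n x => d n x * (fourier 1 x * polyTrace q x)) aestronglyMeasurable_zero
    (Eventually.of_forall fun n => (hint n).integrableOn) (by simpa using hL1)
  simp only [hcompl]
  simpa using hI_lim.neg

theorem MemHardy.tendsto_setIntegral_compl_mul {I : Set UnitTorus} (hI : MeasurableSet I)
    (hIpos : ell I ≠ 0) {d : ℕ → UnitTorus → ℂ} {C : ℝ} (hd : ∀ n, MemHardy 2 (d n))
    (hC : ∀ n, ∀ᵐ x ∂(ell.restrict Iᶜ), ‖d n x‖ ≤ C)
    (hlim : Tendsto (fun n => lpNormOn 2 I (d n)) atTop (𝓝 0)) {h : UnitTorus → ℂ}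
    (hh : MemLpOn 1 Iᶜ h) :
    Tendsto (fun n => ∫ x in Iᶜ, d n x * h x ∂ell) atTop (𝓝 0) := by
  refine tendsto_integral_mul_of_dense (fun n => (hd n).1.1.restrict) hC
    (memLp_one_iff_integrable.1 hh) fun ε hε => ?_
  obtain ⟨q, hq⟩ := exists_polynomial_eLpNorm_one_sub_lt hI hIpos hh hε
  exact ⟨_, memLp_one_iff_integrable.1 (memLp_of_continuous
      ((map_continuous (fourier 1)).mul (continuous_polyTrace q)) 1), hq,
    tendsto_setIntegral_compl_mul_fourier_one_mul_polyTrace hI hd hlim q⟩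

/-! ### Variational inequality and convergence on `I` -/

/-- The restriction to `I` of a function of `H²`, as an element of the Hilbert space `L²(I)`. -/
noncomputable def MemHardy.restrictLp {g : UnitTorus → ℂ} (hg : MemHardy 2 g)
    (I : Set UnitTorus) : Lp ℂ 2 (ell.restrict I) :=
  (hg.1.restrict I).toLp g

/-- The restrictions to `I` of the functions admissible for the bounded extremal problem, as a
subset of `L²(I)`; the extremal problem is the metric projection onto this convex set. -/
def admissibleTraces (I : Set UnitTorus) : Set (Lp ℂ 2 (ell.restrict I)) :=
  {u | ∃ (g : UnitTorus → ℂ) (hg : MemHardy 2 g), BoundedByOneOn Iᶜ g ∧ hg.restrictLp I = u}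

lemma convex_admissibleTraces (I : Set UnitTorus) : Convex ℝ (admissibleTraces I) := by
  rintro _ ⟨g, hg, hgb, rfl⟩ _ ⟨h, hh, hhb, rfl⟩ a b ha hb hab
  refine ⟨fun x => a * g x + b * h x, (hg.const_mul a).add (hh.const_mul b), ?_, ?_⟩
  · filter_upwards [hgb, hhb] with x hgx hhx
    simpa using convex_closedBall (0 : ℂ) 1 (mem_closedBall_zero_iff.2 hgx)
      (mem_closedBall_zero_iff.2 hhx) ha hb hab
  · rw [MemHardy.restrictLp, MemHardy.restrictLp, MemHardy.restrictLp, ← MemLp.toLp_const_smul,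
      ← MemLp.toLp_const_smul, ← MemLp.toLp_add, MemLp.toLp_eq_toLp_iff]
    filter_upwards with x
    simp

section VariationalInequality

variable {I : Set UnitTorus} {f g₀ g h : UnitTorus → ℂ}

lemma norm_toLp_sub_restrictLp (hf : MemLp f 2 (ell.restrict I)) (hg : MemHardy 2 g) :
    ‖hf.toLp f - hg.restrictLp I‖ = (lpNormOn 2 I fun x => f x - g x).toReal :=
  Lp.norm_toLp _ (hf.sub (hg.1.restrict I))

lemma norm_toLp_sub_restrictLp_le_iff (hf : MemLp f 2 (ell.restrict I)) (hg : MemHardy 2 g)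
    (hh : MemHardy 2 h) :
    ‖hf.toLp f - hg.restrictLp I‖ ≤ ‖hf.toLp f - hh.restrictLp I‖ ↔
      (lpNormOn 2 I fun x => f x - g x) ≤ lpNormOn 2 I fun x => f x - h x := by
  rw [norm_toLp_sub_restrictLp, norm_toLp_sub_restrictLp]
  exact ENNReal.toReal_le_toReal (hf.sub (hg.1.restrict I)).2.ne (hf.sub (hh.1.restrict I)).2.ne

lemma IsBEPSolution.inner_sub_restrictLp_le_zero (h₀ : IsBEPSolution I f g₀)
    (hf : MemLp f 2 (ell.restrict I)) (hg : MemHardy 2 g) (hb : BoundedByOneOn Iᶜ g) :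
    inner ℝ (hf.toLp f - h₀.1.restrictLp I) (hg.restrictLp I - h₀.1.restrictLp I) ≤ 0 := by
  have hmem : h₀.1.restrictLp I ∈ admissibleTraces I := ⟨g₀, h₀.1, h₀.2.1, rfl⟩
  have : Nonempty (admissibleTraces I) := ⟨⟨_, hmem⟩⟩
  refine (norm_eq_iInf_iff_real_inner_le_zero (convex_admissibleTraces I) hmem).1
    (le_antisymm (le_ciInf ?_) (ciInf_le ⟨0, Set.forall_mem_range.2 fun _ => norm_nonneg _⟩
      (⟨_, hmem⟩ : admissibleTraces I))) _ ⟨g, hg, hb, rfl⟩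
  rintro ⟨_, q, hq, hqb, rfl⟩
  exact (norm_toLp_sub_restrictLp_le_iff hf h₀.1 hq).2 (h₀.2.2 q hq hqb)

/-- Only an initial segment of the path from `g₀` to `g` has to be admissible. -/
lemma IsBEPSolution.inner_sub_restrictLp_le_zero_of_segment (h₀ : IsBEPSolution I f g₀)
    (hf : MemLp f 2 (ell.restrict I)) (hg : MemHardy 2 g) {s : ℝ} (hs : 0 < s)
    (hb : BoundedByOneOn Iᶜ fun x => g₀ x + s * (g x - g₀ x)) :
    inner ℝ (hf.toLp f - h₀.1.restrictLp I) (hg.restrictLp I - h₀.1.restrictLp I) ≤ 0 := by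
  have hpath := h₀.1.add ((hg.sub h₀.1).const_mul s)
  have hsub : hpath.restrictLp I - h₀.1.restrictLp I =
      s • (hg.restrictLp I - h₀.1.restrictLp I) := by
    rw [MemHardy.restrictLp, MemHardy.restrictLp, MemHardy.restrictLp, ← MemLp.toLp_sub,
      ← MemLp.toLp_sub, ← MemLp.toLp_const_smul, MemLp.toLp_eq_toLp_iff]
    filter_upwards with x
    simp
  have hle := h₀.inner_sub_restrictLp_le_zero hf hpath hb
  rw [hsub, real_inner_smul_right] at hle
  exact nonpos_of_mul_nonpos_right hle hs

lemma IsBEPSolution.norm_restrictLp_sub_sq_le (h₀ : IsBEPSolution I f g₀)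
    (hf : MemLp f 2 (ell.restrict I)) (hg : MemHardy 2 g) (hb : BoundedByOneOn Iᶜ g) :
    ‖h₀.1.restrictLp I - hg.restrictLp I‖ ^ 2 ≤
      ‖hf.toLp f - hg.restrictLp I‖ ^ 2 - ‖hf.toLp f - h₀.1.restrictLp I‖ ^ 2 := by
  have hinner := h₀.inner_sub_restrictLp_le_zero hf hg hb
  have hexpand := norm_sub_sq_real (hf.toLp f - h₀.1.restrictLp I)
    (hg.restrictLp I - h₀.1.restrictLp I)
  rw [sub_sub_sub_cancel_right] at hexpand
  rw [norm_sub_rev]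
  linarith

end VariationalInequality

section PolynomialSolutions

variable {I : Set UnitTorus} {f g₀ : UnitTorus → ℂ} {k : ℕ → Polynomial ℂ}

lemma IsBEPSolution.tendsto_norm_sub_restrictLp_polyTrace (h₀ : IsBEPSolution I f g₀)
    (hI : MeasurableSet I) (hI0 : ell (I \ interior I) = 0) (hf : MemLp f 2 (ell.restrict I))
    (hk : ∀ n, IsFBEPSolution I f n (k n)) :
    Tendsto (fun n => ‖hf.toLp f - (memHardy_polyTrace (k n) 2).restrictLp I‖) atTop
      (𝓝 ‖hf.toLp f - h₀.1.restrictLp I‖) := by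
  have hJ0 : ell (closure Iᶜ \ Iᶜ) = 0 := by
    rwa [closure_compl, Set.sdiff_compl, Set.inter_comm, ← Set.sdiff_eq]
  rw [Metric.tendsto_atTop]
  intro ε hε
  obtain ⟨q, hqb, hqε⟩ := h₀.1.exists_polynomial_bounded hI.compl hJ0 h₀.2.1
    (ENNReal.ofReal_pos.2 hε)
  refine ⟨q.natDegree, fun n hn => ?_⟩
  have hlower : ‖hf.toLp f - h₀.1.restrictLp I‖ ≤
      ‖hf.toLp f - (memHardy_polyTrace (k n) 2).restrictLp I‖ :=
    (norm_toLp_sub_restrictLp_le_iff hf _ _).2 (h₀.2.2 _ (memHardy_polyTrace (k n) 2) (hk n).2.1)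
  have hupper : ‖hf.toLp f - (memHardy_polyTrace (k n) 2).restrictLp I‖ ≤
      ‖hf.toLp f - (memHardy_polyTrace q 2).restrictLp I‖ :=
    (norm_toLp_sub_restrictLp_le_iff hf _ _).2
      ((hk n).2.2 q hn (ae_restrict_of_forall_mem hI.compl hqb))
  have hclose : ‖(memHardy_polyTrace q 2).restrictLp I - h₀.1.restrictLp I‖ < ε := by
    rw [MemHardy.restrictLp, norm_toLp_sub_restrictLp]
    exact ENNReal.toReal_lt_of_lt_ofReal
      ((eLpNorm_mono_measure _ Measure.restrict_le_self).trans_lt hqε)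
  have htriangle := norm_sub_le_norm_sub_add_norm_sub (hf.toLp f)
    (h₀.1.restrictLp I) ((memHardy_polyTrace q 2).restrictLp I)
  rw [norm_sub_rev (h₀.1.restrictLp I)] at htriangle
  rw [Real.dist_eq, abs_of_nonneg (sub_nonneg.2 hlower)]
  linarith

lemma IsBEPSolution.tendsto_lpNormOn_sub_polyTrace (h₀ : IsBEPSolution I f g₀)
    (hI : MeasurableSet I) (hI0 : ell (I \ interior I) = 0) (hf : MemLp f 2 (ell.restrict I))
    (hk : ∀ n, IsFBEPSolution I f n (k n)) :
    Tendsto (fun n => lpNormOn 2 I fun x => g₀ x - polyTrace (k n) x) atTop (𝓝 0) := by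
  have hgap := ((h₀.tendsto_norm_sub_restrictLp_polyTrace hI hI0 hf hk).pow 2).sub_const
    (‖hf.toLp f - h₀.1.restrictLp I‖ ^ 2)
  rw [sub_self] at hgap
  have hnorm := (squeeze_zero (fun n => by positivity)
    (fun n => h₀.norm_restrictLp_sub_sq_le hf (memHardy_polyTrace (k n) 2) (hk n).2.1) hgap).sqrt
  rw [Real.sqrt_zero] at hnorm
  refine (ENNReal.tendsto_toReal_iff (fun n => ?_) ENNReal.zero_ne_top).1
    (hnorm.congr fun n => ?_)
  · exact ((h₀.1.sub (memHardy_polyTrace (k n) 2)).1.restrict I).2.ne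
  · rw [Real.sqrt_sq (norm_nonneg _)]
    exact norm_toLp_sub_restrictLp (h₀.1.1.restrict I) (memHardy_polyTrace (k n) 2)

end PolynomialSolutions

/-! ### Saturation of the constraint -/

lemma exists_measurableSet_norm_le_one_sub {α E : Type*} [MeasurableSpace α] {μ : Measure α}
    [NormedAddCommGroup E] {g : α → E} (hg : AEStronglyMeasurable g μ)
    (hb : ∀ᵐ x ∂μ, ‖g x‖ ≤ 1) (hne : ¬ ∀ᵐ x ∂μ, ‖g x‖ = 1) :
    ∃ η > 0, ∃ s, MeasurableSet s ∧ μ s ≠ 0 ∧ ∀ x ∈ s, ‖g x‖ ≤ 1 - η := by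
  have hnull (n : ℕ) : NullMeasurableSet {x | ‖g x‖ ≤ 1 - 1 / ((n : ℝ) + 1)} μ :=
    nullMeasurableSet_le hg.norm.aemeasurable aemeasurable_const
  by_contra! hcon
  refine hne ?_
  have hlt (n : ℕ) : ∀ᵐ x ∂μ, 1 - 1 / ((n : ℝ) + 1) < ‖g x‖ := by
    obtain ⟨t, hts, ht, hteq⟩ := (hnull n).exists_measurable_subset_ae_eq
    have ht0 : μ t = 0 := by
      by_contra h0
      obtain ⟨x, hx, hlt⟩ := hcon (1 / ((n : ℝ) + 1)) (by positivity) t ht h0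
      exact hlt.not_ge (hts hx)
    simpa only [ae_iff, not_lt] using (measure_congr hteq).symm.trans ht0
  have hlim : Tendsto (fun n : ℕ => 1 - 1 / ((n : ℝ) + 1)) atTop (𝓝 1) := by
    simpa using tendsto_one_div_add_atTop_nhds_zero_nat.const_sub (1 : ℝ)
  filter_upwards [ae_all_iff.2 hlt, hb] with x hlt hle
  exact hle.antisymm (le_of_tendsto' hlim fun n => (hlt n).le)

lemma norm_add_mul_sub_le {z w : ℂ} {s : ℝ} (hs₀ : 0 ≤ s) (hs₁ : s ≤ 1) :
    ‖z + s * (w - z)‖ ≤ (1 - s) * ‖z‖ + s * ‖w‖ := by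
  have hsplit : z + s * (w - z) = (1 - s : ℝ) * z + s * w := by push_cast; ring
  rw [hsplit]
  refine (norm_add_le _ _).trans_eq ?_
  rw [norm_mul, norm_mul, Complex.norm_of_nonneg (sub_nonneg.2 hs₁), Complex.norm_of_nonneg hs₀]

lemma norm_mul_exp_neg_le {z W : ℂ} (hW : 0 ≤ W.re) : ‖z * Complex.exp (-W)‖ ≤ ‖z‖ := by
  rw [norm_mul, Complex.norm_exp, Complex.neg_re]
  exact mul_le_of_le_one_right (norm_nonneg z) (Real.exp_le_one_iff.2 (neg_nonpos.2 hW))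

section Saturation

variable {I E : Set UnitTorus} {f g₀ : UnitTorus → ℂ}

/-- On `E` there is room for a small multiple of any bounded perturbation, and on `Iᶜ \ E` the
damping factor `exp (-W)` restores the constraint. -/
lemma IsBEPSolution.inner_sub_restrictLp_mul_exp_neg_le_zero (h₀ : IsBEPSolution I f g₀)
    (hf : MemLp f 2 (ell.restrict I)) {η : ℝ} (hη : 0 < η) (hE : ∀ x ∈ E, ‖g₀ x‖ ≤ 1 - η)
    (p : Polynomial ℂ) {W : UnitTorus → ℂ} (hW : MemHardy 2 W)
    (hre : ∀ᵐ x ∂ell, 0 ≤ (W x).re)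
    (hdom : ∀ᵐ x ∂(ell.restrict Iᶜ), x ∉ E → ‖polyTrace p x‖ ≤ (W x).re) :
    inner ℝ (hf.toLp f - h₀.1.restrictLp I)
      (((h₀.1.add (memHardy_polyTrace p 2)).mul_exp_neg hW hre).restrictLp I -
        h₀.1.restrictLp I) ≤ 0 := by
  obtain ⟨M, hM⟩ :=
    isCompact_univ.exists_bound_of_continuousOn (continuous_polyTrace p).continuousOn
  have hM₀ : 0 ≤ M := (norm_nonneg _).trans (hM 0 trivial)
  have hs₀ : 0 < η / (η + M) := by positivity
  have hs₁ : η / (η + M) ≤ 1 := div_le_one_of_le₀ (by linarith) (by positivity)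
  have hsM : η / (η + M) * (η + M) = η := div_mul_cancel₀ _ (by positivity)
  refine h₀.inner_sub_restrictLp_le_zero_of_segment hf _ hs₀ ?_
  filter_upwards [h₀.2.1, hdom, ae_restrict_of_ae hre] with x hx hdom hre
  refine (norm_add_mul_sub_le hs₀.le hs₁).trans ?_
  by_cases hxE : x ∈ E
  · have hbound : ‖(g₀ x + polyTrace p x) * Complex.exp (-W x)‖ ≤ 1 - η + M :=
      (norm_mul_exp_neg_le hre).trans (norm_add_le_of_le (hE x hxE) (hM x trivial))
    nlinarith [mul_le_mul_of_nonneg_left hbound hs₀.le,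
      mul_le_mul_of_nonneg_left (hE x hxE) (sub_nonneg.2 hs₁)]
  · have hbound : ‖(g₀ x + polyTrace p x) * Complex.exp (-W x)‖ ≤ 1 :=
      norm_mul_exp_neg_le_one (norm_add_le_of_le hx (hdom hxE))
    nlinarith [mul_le_mul_of_nonneg_left hbound hs₀.le,
      mul_le_mul_of_nonneg_left hx (sub_nonneg.2 hs₁)]

lemma exists_polynomial_damping (hI : MeasurableSet I) (hE : MeasurableSet E)
    (hEI : E ⊆ Iᶜ) (hE0 : ell E ≠ 0) {u : UnitTorus → ℂ} (hu : MemLp u 2 (ell.restrict I))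
    {ε : ℝ≥0∞} (hε : 0 < ε) :
    ∃ (p : Polynomial ℂ) (W : UnitTorus → ℂ), MemHardy 2 W ∧ (∀ᵐ x ∂ell, 0 ≤ (W x).re) ∧
      (∀ᵐ x ∂(ell.restrict Iᶜ), x ∉ E → ‖polyTrace p x‖ ≤ (W x).re) ∧
      eLpNorm (fun x => polyTrace p x - u x) 2 (ell.restrict I) < ε ∧
      eLpNorm W 2 ell ≤ 2 * ε := by
  obtain ⟨p, hp⟩ := exists_polynomial_eLpNorm_two_sub_lt hE hE0
    (((memLp_indicator_iff_restrict hI).2 hu).restrict Eᶜ) hε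
  have hmeas : MeasurableSet (Iᶜ \ E) := hI.compl.diff hE
  obtain ⟨W, hW, hWre, -, hWnorm⟩ := exists_memHardy_re_eq
    (((memHardy_polyTrace p 2).1.norm).indicator hmeas)
  have hp_on {s : Set UnitTorus} (hs : MeasurableSet s) (hsE : s ⊆ Eᶜ) {v : UnitTorus → ℂ}
      (hv : ∀ x ∈ s, v x = polyTrace p x - I.indicator u x) :
      eLpNorm v 2 (ell.restrict s) < ε := by
    rw [eLpNorm_congr_ae (ae_restrict_of_forall_mem hs hv)]
    exact (eLpNorm_mono_measure _ (Measure.restrict_mono_set ell hsE)).trans_lt hp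
  refine ⟨p, W, hW, ?_, ?_, ?_, hWnorm.trans (mul_le_mul_right ?_ 2)⟩
  · filter_upwards [hWre] with x hx
    rw [hx]
    exact Set.indicator_nonneg (fun _ _ => norm_nonneg _) x
  · filter_upwards [ae_restrict_of_ae hWre, ae_restrict_mem hI.compl] with x hx hxI hxE
    rw [hx, Set.indicator_of_mem (Set.mem_sdiff_of_mem hxI hxE)]
  · exact hp_on hI (Set.subset_compl_comm.1 hEI) fun x hx => by rw [Set.indicator_of_mem hx]
  · rw [eLpNorm_indicator_eq_eLpNorm_restrict hmeas, eLpNorm_norm]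
    exact (hp_on hmeas (fun x hx => hx.2) fun x hx => by
      rw [Set.indicator_of_notMem hx.1, sub_zero]).le

lemma tendsto_eLpNorm_restrict_mul_exp_neg_sub (hI : MeasurableSet I)
    (hf : MemLp f 2 (ell.restrict I)) {r W : ℕ → UnitTorus → ℂ}
    (hr : ∀ n, MemLp (r n) 2 (ell.restrict I)) (hW : ∀ n, MemLp (W n) 2 ell)
    (hre : ∀ n, ∀ᵐ x ∂ell, 0 ≤ (W n x).re)
    (hrlim : Tendsto (fun n => eLpNorm (fun x => r n x - f x) 2 (ell.restrict I)) atTop (𝓝 0))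
    (hWlim : Tendsto (fun n => eLpNorm (W n) 2 ell) atTop (𝓝 0)) :
    Tendsto (fun n => eLpNorm (fun x => r n x * Complex.exp (-W n x) - f x) 2 (ell.restrict I))
      atTop (𝓝 0) := by
  have hF : MemLp (I.indicator f) 2 ell := (memLp_indicator_iff_restrict hI).2 hf
  have hbound := hrlim.add (tendsto_eLpNorm_mul_exp_neg_sub hF hW hre hWlim)
  rw [add_zero] at hbound
  refine tendsto_of_tendsto_of_tendsto_of_le_of_le tendsto_const_nhds hbound (fun _ => zero_le)
    fun n => ?_
  have hexp : AEStronglyMeasurable (fun x => Complex.exp (-W n x)) ell :=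
    Complex.continuous_exp.comp_aestronglyMeasurable (hW n).1.neg
  have hsplit : (fun x => r n x * Complex.exp (-W n x) - f x) =ᵐ[ell.restrict I]
      (fun x => (r n x - f x) * Complex.exp (-W n x)) +
        fun x => I.indicator f x * Complex.exp (-W n x) - I.indicator f x := by
    filter_upwards [ae_restrict_mem hI] with x hx
    rw [Pi.add_apply, Set.indicator_of_mem hx]
    ring
  rw [eLpNorm_congr_ae hsplit]
  refine (eLpNorm_add_le (((hr n).1.sub hf.1).mul hexp.restrict)
    ((hF.1.mul hexp).sub hF.1).restrict one_le_two).trans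
    (add_le_add (eLpNorm_mono_ae ?_) (eLpNorm_mono_measure _ Measure.restrict_le_self))
  filter_upwards [ae_restrict_of_ae (hre n)] with x hx using norm_mul_exp_neg_le hx

theorem IsBEPSolution.ae_eq_of_not_saturated (h₀ : IsBEPSolution I f g₀) (hI : MeasurableSet I)
    (hf : MemLp f 2 (ell.restrict I)) (hns : ¬ ∀ᵐ x ∂(ell.restrict Iᶜ), ‖g₀ x‖ = 1) :
    f =ᵐ[ell.restrict I] g₀ := by
  obtain ⟨η, hη, s, hs, hs0, hsη⟩ :=
    exists_measurableSet_norm_le_one_sub h₀.1.1.1.restrict h₀.2.1 hns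
  rw [Measure.restrict_apply hs] at hs0
  have hu : MemLp (fun x => f x - g₀ x) 2 (ell.restrict I) := hf.sub (h₀.1.1.restrict I)
  have hε : Tendsto (fun n : ℕ => ((n : ℝ≥0∞) + 1)⁻¹) atTop (𝓝 0) := by
    simpa using (tendsto_add_atTop_iff_nat 1).2 ENNReal.tendsto_inv_nat_nhds_zero
  choose p W hW hre hdom hp hWnorm using fun n : ℕ =>
    exists_polynomial_damping hI (hs.inter hI.compl) Set.inter_subset_right hs0 hu
      (ENNReal.inv_pos.2 (ENNReal.add_ne_top.2 ⟨ENNReal.natCast_ne_top n, ENNReal.one_ne_top⟩))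
  have hrlim : Tendsto (fun n => eLpNorm (fun x => g₀ x + polyTrace (p n) x - f x) 2
      (ell.restrict I)) atTop (𝓝 0) := by
    refine tendsto_of_tendsto_of_tendsto_of_le_of_le tendsto_const_nhds hε (fun _ => zero_le)
      fun n => (le_of_eq ?_).trans (hp n).le
    simp only [sub_sub_eq_add_sub, add_comm]
  have hWlim : Tendsto (fun n => eLpNorm (W n) 2 ell) atTop (𝓝 0) :=
    tendsto_of_tendsto_of_tendsto_of_le_of_le tendsto_const_nhds
      (by simpa using ENNReal.Tendsto.const_mul hε (a := 2) (by simp)) (fun _ => zero_le) hWnorm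
  have hG (n : ℕ) := h₀.1.add (memHardy_polyTrace (p n) 2)
  have hlim : Tendsto (fun n => ((hG n).mul_exp_neg (hW n) (hre n)).restrictLp I) atTop
      (𝓝 (hf.toLp f)) :=
    (Lp.tendsto_Lp_iff_tendsto_eLpNorm'' _ _ _ hf).2
      (tendsto_eLpNorm_restrict_mul_exp_neg_sub hI hf (fun n => (hG n).1.restrict I)
        (fun n => (hW n).1) hre hrlim hWlim)
  have hinner : inner ℝ (hf.toLp f - h₀.1.restrictLp I) (hf.toLp f - h₀.1.restrictLp I) ≤ 0 :=
    le_of_tendsto' (tendsto_const_nhds.inner (hlim.sub_const _)) fun n =>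
      h₀.inner_sub_restrictLp_mul_exp_neg_le_zero hf hη (fun x hx => hsη x hx.1) (p n) (hW n)
        (hre n) (hdom n)
  exact (MemLp.toLp_eq_toLp_iff hf (h₀.1.1.restrict I)).1
    (sub_eq_zero.1 (real_inner_self_nonpos.1 hinner))

end Saturation

/-! ### Norm convergence under saturation -/

lemma norm_sub_sq_le_two_mul_re {z w : ℂ} (hz : ‖z‖ = 1) (hw : ‖w‖ ≤ 1) :
    ‖z - w‖ ^ 2 ≤ 2 * ((z - w) * (starRingEnd ℂ) z).re := by
  have hz_sq : Complex.normSq z = 1 := by rw [Complex.normSq_eq_norm_sq, hz, one_pow]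
  have hw_sq : Complex.normSq w ≤ 1 := by
    rw [Complex.normSq_eq_norm_sq]
    exact pow_le_one₀ (norm_nonneg w) hw
  rw [← Complex.normSq_eq_norm_sq, Complex.normSq_sub, sub_mul, Complex.mul_conj, Complex.sub_re,
    Complex.ofReal_re, ← Complex.conj_re (w * _), map_mul, Complex.conj_conj, mul_comm _ z]
  linarith

section Saturated

variable {α : Type*} [MeasurableSpace α] {μ : Measure α} [IsFiniteMeasure μ] {g : α → ℂ}
  {k : ℕ → α → ℂ}

lemma tendsto_eLpNorm_two_sub_of_norm_eq_one (hg : AEStronglyMeasurable g μ)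
    (hk : ∀ n, AEStronglyMeasurable (k n) μ) (hg1 : ∀ᵐ x ∂μ, ‖g x‖ = 1)
    (hk1 : ∀ n, ∀ᵐ x ∂μ, ‖k n x‖ ≤ 1)
    (hlim : Tendsto (fun n => ∫ x, (g x - k n x) * (starRingEnd ℂ) (g x) ∂μ) atTop (𝓝 0)) :
    Tendsto (fun n => eLpNorm (fun x => g x - k n x) 2 μ) atTop (𝓝 0) := by
  have hg_mem : MemLp g 2 μ := .of_bound hg 1 (hg1.mono fun _ hx => hx.le)
  have hd (n : ℕ) : MemLp (fun x => g x - k n x) 2 μ := hg_mem.sub (.of_bound (hk n) 1 (hk1 n))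
  have hle (n : ℕ) : ∫ x, ‖g x - k n x‖ ^ 2 ∂μ ≤
      2 * (∫ x, (g x - k n x) * (starRingEnd ℂ) (g x) ∂μ).re := by
    have hint : Integrable (fun x => (g x - k n x) * (starRingEnd ℂ) (g x)) μ :=
      (hd n).integrable_mul hg_mem.star
    have hre : (∫ x, (g x - k n x) * (starRingEnd ℂ) (g x) ∂μ).re =
        ∫ x, ((g x - k n x) * (starRingEnd ℂ) (g x)).re ∂μ := (integral_re hint).symm
    rw [hre, ← integral_const_mul]
    refine integral_mono_ae ((hd n).integrable_norm_pow two_ne_zero) (hint.re.const_mul 2) ?_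
    filter_upwards [hg1, hk1 n] with x hgx hkx using norm_sub_sq_le_two_mul_re hgx hkx
  have hre_lim : Tendsto (fun n => 2 * (∫ x, (g x - k n x) * (starRingEnd ℂ) (g x) ∂μ).re) atTop
      (𝓝 0) := by
    simpa using ((Complex.continuous_re.tendsto 0).comp hlim).const_mul 2
  have hsqrt := (squeeze_zero (fun n => integral_nonneg fun x => by positivity) hle hre_lim).sqrt
  rw [Real.sqrt_zero] at hsqrt
  refine (ENNReal.tendsto_toReal_iff (fun n => (hd n).2.ne) ENNReal.zero_ne_top).1
    (hsqrt.congr fun n => ?_)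
  rw [← toReal_eLpNorm_two_sq (hd n), Real.sqrt_sq ENNReal.toReal_nonneg]

lemma tendsto_eLpNorm_sub_of_norm_eq_one (hg : AEStronglyMeasurable g μ)
    (hk : ∀ n, AEStronglyMeasurable (k n) μ) (hg1 : ∀ᵐ x ∂μ, ‖g x‖ = 1)
    (hk1 : ∀ n, ∀ᵐ x ∂μ, ‖k n x‖ ≤ 1)
    (hlim : Tendsto (fun n => ∫ x, (g x - k n x) * (starRingEnd ℂ) (g x) ∂μ) atTop (𝓝 0))
    {p : ℝ≥0∞} (hp : 1 ≤ p) (hp' : p ≠ ⊤) :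
    Tendsto (fun n => eLpNorm (fun x => g x - k n x) p μ) atTop (𝓝 0) := by
  refine tendsto_eLpNorm_of_tendstoInMeasure_of_norm_le hp hp' (fun n => hg.sub (hk n))
    (memLp_const (2 : ℝ)) (fun n => ?_)
    (tendstoInMeasure_of_tendsto_eLpNorm two_ne_zero (fun n => hg.sub (hk n))
      aestronglyMeasurable_zero ?_)
  · filter_upwards [hg1, hk1 n] with x hgx hkx
    exact (norm_sub_le_of_le hgx.le hkx).trans_eq one_add_one_eq_two
  · simpa only [sub_zero] using tendsto_eLpNorm_two_sub_of_norm_eq_one hg hk hg1 hk1 hlim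

end Saturated

/-! ### Convergence on the complement -/

section Complement

variable {I : Set UnitTorus} {f g₀ : UnitTorus → ℂ} {k : ℕ → Polynomial ℂ}

lemma IsBEPSolution.tendsto_setIntegral_compl_sub_polyTrace_mul (h₀ : IsBEPSolution I f g₀)
    (hI : MeasurableSet I) (hI0 : ell (I \ interior I) = 0) (hIpos : ell I ≠ 0)
    (hf : MemLp f 2 (ell.restrict I)) (hk : ∀ n, IsFBEPSolution I f n (k n))
    {h : UnitTorus → ℂ} (hh : MemLpOn 1 Iᶜ h) :
    Tendsto (fun n => ∫ x in Iᶜ, (g₀ x - polyTrace (k n) x) * h x ∂ell) atTop (𝓝 0) := by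
  refine MemHardy.tendsto_setIntegral_compl_mul (C := 2) hI hIpos
    (fun n => h₀.1.sub (memHardy_polyTrace (k n) 2)) (fun n => ?_)
    (h₀.tendsto_lpNormOn_sub_polyTrace hI hI0 hf hk) hh
  filter_upwards [h₀.2.1, (hk n).2.1] with x hgx hkx
  exact (norm_sub_le_of_le hgx hkx).trans_eq one_add_one_eq_two

lemma IsBEPSolution.tendsto_pairingOn_compl_polyTrace (h₀ : IsBEPSolution I f g₀)
    (hI : MeasurableSet I) (hI0 : ell (I \ interior I) = 0) (hIpos : ell I ≠ 0)
    (hf : MemLp f 2 (ell.restrict I)) (hk : ∀ n, IsFBEPSolution I f n (k n))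
    {h : UnitTorus → ℂ} (hh : MemLpOn 1 Iᶜ h) :
    Tendsto (fun n => pairingOn Iᶜ (polyTrace (k n)) h) atTop (𝓝 (pairingOn Iᶜ g₀ h)) := by
  have hh_conj : MemLpOn 1 Iᶜ fun x => (starRingEnd ℂ) (h x) := hh.star
  have hh_int := memLp_one_iff_integrable.1 hh_conj
  have hdiff := (h₀.tendsto_setIntegral_compl_sub_polyTrace_mul hI hI0 hIpos hf hk
    hh_conj).const_sub (pairingOn Iᶜ g₀ h)
  rw [sub_zero] at hdiff
  refine hdiff.congr fun n => ?_
  simp only [pairingOn, sub_mul]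
  rw [integral_sub (hh_int.bdd_mul h₀.1.1.1.restrict h₀.2.1)
    (hh_int.bdd_mul (memHardy_polyTrace (k n) 2).1.1.restrict (hk n).2.1), sub_sub_cancel]

lemma IsBEPSolution.tendsto_lpNormOn_compl_sub_polyTrace (h₀ : IsBEPSolution I f g₀)
    (hI : MeasurableSet I) (hI0 : ell (I \ interior I) = 0) (hIpos : ell I ≠ 0)
    (hf : MemLp f 2 (ell.restrict I)) (hk : ∀ n, IsFBEPSolution I f n (k n))
    (hsat : ∀ᵐ x ∂(ell.restrict Iᶜ), ‖g₀ x‖ = 1) {p : ℝ≥0∞} (hp : 1 ≤ p) (hp' : p ≠ ⊤) :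
    Tendsto (fun n => lpNormOn p Iᶜ fun x => g₀ x - polyTrace (k n) x) atTop (𝓝 0) :=
  tendsto_eLpNorm_sub_of_norm_eq_one h₀.1.1.1.restrict
    (fun n => (memHardy_polyTrace (k n) 2).1.1.restrict) hsat (fun n => (hk n).2.1)
    (h₀.tendsto_setIntegral_compl_sub_polyTrace_mul hI hI0 hIpos hf hk
      ((h₀.1.1.restrict Iᶜ).star.mono_exponent one_le_two)) hp hp'

lemma lpNormOn_univ_le_add_compl (hI : MeasurableSet I) {p : ℝ≥0∞} (hp : 1 ≤ p)
    {d : UnitTorus → ℂ} (hd : AEStronglyMeasurable d ell) :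
    lpNormOn p Set.univ d ≤ lpNormOn p I d + lpNormOn p Iᶜ d := by
  simp only [lpNormOn, Measure.restrict_univ]
  rw [← eLpNorm_indicator_eq_eLpNorm_restrict hI, ← eLpNorm_indicator_eq_eLpNorm_restrict hI.compl]
  simpa only [Set.indicator_self_add_compl] using
    eLpNorm_add_le (hd.indicator hI) (hd.indicator hI.compl) hp

end Complement

/-! ### Finite unions of closed arcs -/

lemma ell_singleton (x : UnitTorus) : ell {x} = 0 := by
  have hvol := AddCircle.volume_closedBall (2 * π) (x := x) 0
  rw [Metric.closedBall_zero, volume_eq_smul_haarAddCircle] at hvol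
  simpa only [ell, mul_zero, min_eq_right Real.two_pi_pos.le, ENNReal.ofReal_zero,
    Measure.smul_apply, smul_eq_mul, mul_eq_zero, ENNReal.ofReal_eq_zero,
    not_le.2 Real.two_pi_pos, false_or] using hvol

lemma image_coe_Icc_diff_interior_subset (a b : ℝ) :
    ((fun θ : ℝ => (θ : UnitTorus)) '' Set.Icc a b) \
      interior ((fun θ : ℝ => (θ : UnitTorus)) '' Set.Icc a b) ⊆
        {(a : UnitTorus), (b : UnitTorus)} := by
  rintro _ ⟨⟨θ, hθ, rfl⟩, hinterior⟩
  have hopen : IsOpen ((fun θ : ℝ => (θ : UnitTorus)) '' Set.Ioo a b) :=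
    QuotientAddGroup.isOpenMap_coe _ isOpen_Ioo
  have hθ_notMem : θ ∉ Set.Ioo a b := fun h => hinterior
    (interior_maximal (Set.image_mono Set.Ioo_subset_Icc_self) hopen ⟨θ, h, rfl⟩)
  rcases hθ.1.eq_or_lt with rfl | haθ
  · exact Set.mem_insert _ _
  rcases hθ.2.eq_or_lt with rfl | hθb
  · exact Set.mem_insert_of_mem _ rfl
  · exact absurd ⟨haθ, hθb⟩ hθ_notMem

lemma IsFiniteUnionOfClosedArcs.isClosed {I : Set UnitTorus} (hI : IsFiniteUnionOfClosedArcs I) :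
    IsClosed I := by
  obtain ⟨N, a, b, rfl⟩ := hI
  exact isClosed_iUnion_of_finite fun j =>
    (isCompact_Icc.image (AddCircle.continuous_mk' _)).isClosed

lemma IsFiniteUnionOfClosedArcs.ell_diff_interior {I : Set UnitTorus}
    (hI : IsFiniteUnionOfClosedArcs I) : ell (I \ interior I) = 0 := by
  obtain ⟨N, a, b, rfl⟩ := hI
  refine measure_mono_null (t := ⋃ j, {(a j : UnitTorus), (b j : UnitTorus)}) ?_ ?_
  · rintro x ⟨hx, hinterior⟩
    obtain ⟨j, hj⟩ := Set.mem_iUnion.1 hx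
    refine Set.mem_iUnion.2 ⟨j, image_coe_Icc_diff_interior_subset (a j) (b j)
      ⟨hj, fun h => hinterior (interior_mono ?_ h)⟩⟩
    exact Set.subset_iUnion (fun j => (fun θ : ℝ => (θ : UnitTorus)) '' Set.Icc (a j) (b j)) j
  · exact measure_iUnion_null fun j =>
      measure_union_null (ell_singleton (a j)) (ell_singleton (b j))

end BoundedExtremal

theorem mainTheorem9_general
    {I : Set UnitTorus} (hI : MeasurableSet I) (hI0 : BoundedExtremal.ell (I \ interior I) = 0)
    (hIpos : BoundedExtremal.ell I ≠ 0)
    {f : UnitTorus → ℂ} (hf : BoundedExtremal.MemLpOn 2 I f)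
    {g₀ : UnitTorus → ℂ} (hg₀ : BoundedExtremal.IsBEPSolution I f g₀)
    {k : ℕ → Polynomial ℂ} (hk : ∀ n, BoundedExtremal.IsFBEPSolution I f n (k n)) :
    (Tendsto (fun n => BoundedExtremal.lpNormOn 2 I
        (fun x => g₀ x - BoundedExtremal.polyTrace (k n) x)) atTop (𝓝 0) ∧
      ∀ h : UnitTorus → ℂ, BoundedExtremal.MemLpOn 1 Iᶜ h →
        Tendsto (fun n => BoundedExtremal.pairingOn Iᶜ (BoundedExtremal.polyTrace (k n)) h) atTop
          (𝓝 (BoundedExtremal.pairingOn Iᶜ g₀ h))) ∧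
    ((∀ g : UnitTorus → ℂ, BoundedExtremal.MemHardy 2 g → BoundedExtremal.BoundedByOneOn Iᶜ g →
        (∀ᵐ x ∂(BoundedExtremal.ell.restrict I), f x = g x) →
        ∀ᵐ x ∂(BoundedExtremal.ell.restrict Iᶜ), ‖g x‖ = 1) →
      Tendsto (fun n => BoundedExtremal.lpNormOn 2 Set.univ
        (fun x => g₀ x - BoundedExtremal.polyTrace (k n) x)) atTop (𝓝 0) ∧
      ∀ p : ℝ≥0∞, 1 ≤ p → p ≠ ⊤ →
        Tendsto (fun n => BoundedExtremal.lpNormOn p Iᶜ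
          (fun x => g₀ x - BoundedExtremal.polyTrace (k n) x)) atTop (𝓝 0)) := by
  have hconv := hg₀.tendsto_lpNormOn_sub_polyTrace hI hI0 hf hk
  refine ⟨⟨hconv, fun h hh =>
    hg₀.tendsto_pairingOn_compl_polyTrace hI hI0 hIpos hf hk hh⟩, fun hsat => ?_⟩
  have hg₀_sat : ∀ᵐ x ∂(BoundedExtremal.ell.restrict Iᶜ), ‖g₀ x‖ = 1 := by
    by_contra hns
    exact hns (hsat g₀ hg₀.1 hg₀.2.1 (hg₀.ae_eq_of_not_saturated hI hf hns))
  have hconv_compl {p : ℝ≥0∞} (hp : 1 ≤ p) (hp' : p ≠ ⊤) :=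
    hg₀.tendsto_lpNormOn_compl_sub_polyTrace hI hI0 hIpos hf hk hg₀_sat hp hp'
  refine ⟨?_, fun p => hconv_compl⟩
  have hsum := hconv.add (hconv_compl one_le_two ENNReal.ofNat_ne_top)
  rw [add_zero] at hsum
  exact tendsto_of_tendsto_of_tendsto_of_le_of_le tendsto_const_nhds hsum (fun _ => zero_le)
    fun n => BoundedExtremal.lpNormOn_univ_le_add_compl hI one_le_two
      (hg₀.1.sub (BoundedExtremal.memHardy_polyTrace (k n) 2)).1.1

theorem mainTheorem9
    (I : Set UnitTorus) (hI : BoundedExtremal.IsFiniteUnionOfClosedArcs I)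
    (hIpos : 0 < BoundedExtremal.ell I) (hJpos : 0 < BoundedExtremal.ell Iᶜ)
    (f : UnitTorus → ℂ) (hf : BoundedExtremal.MemLpOn 2 I f)
    (g₀ : UnitTorus → ℂ) (hg₀ : BoundedExtremal.IsBEPSolution I f g₀)
    (k : ℕ → Polynomial ℂ) (hk : ∀ n, BoundedExtremal.IsFBEPSolution I f n (k n)) :
    -- for every `f`: convergence in `L²(I)` and weak-* convergence in `L^∞(J)`
    (Tendsto (fun n => BoundedExtremal.lpNormOn 2 I
        (fun x => g₀ x - BoundedExtremal.polyTrace (k n) x)) atTop (𝓝 0) ∧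
      ∀ h : UnitTorus → ℂ, BoundedExtremal.MemLpOn 1 Iᶜ h →
        Tendsto (fun n => BoundedExtremal.pairingOn Iᶜ (BoundedExtremal.polyTrace (k n)) h) atTop
          (𝓝 (BoundedExtremal.pairingOn Iᶜ g₀ h))) ∧
    -- norm convergence, unless `f` is the trace of an admissible function that does not
    -- saturate the constraint
    ((∀ g : UnitTorus → ℂ, BoundedExtremal.MemHardy 2 g → BoundedExtremal.BoundedByOneOn Iᶜ g →
        (∀ᵐ x ∂(BoundedExtremal.ell.restrict I), f x = g x) →
        ∀ᵐ x ∂(BoundedExtremal.ell.restrict Iᶜ), ‖g x‖ = 1) →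
      Tendsto (fun n => BoundedExtremal.lpNormOn 2 Set.univ
        (fun x => g₀ x - BoundedExtremal.polyTrace (k n) x)) atTop (𝓝 0) ∧
      ∀ p : ℝ≥0∞, 1 ≤ p → p ≠ ⊤ →
        Tendsto (fun n => BoundedExtremal.lpNormOn p Iᶜ
          (fun x => g₀ x - BoundedExtremal.polyTrace (k n) x)) atTop (𝓝 0)) :=
  mainTheorem9_general hI.isClosed.measurableSet hI.ell_diff_interior hIpos.ne' hf hg₀ hk
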